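/- **Notation.** Let $d\in\mathbb N$. For vectors in $\mathbb R^d$ the relations $<$ and $\le$ are meant in every component, and $\mathbb R^d_+=(0,\infty)^d$. For $r\in\mathbb R^d_+$ let $D_r(0)=\{z\in\mathbb C^d : |z_j|<r_j,\ j=1,\dots,d\}$. For $\Omega\subseteq\mathbb C^d$ open, $A(\Omega)$ is the set of analytic functions in $\Omega$; for $\Omega$ closed, $A(\Omega)$ is the set of functions analytic in an open neighbourhood of $\Omega$. Let $(z,w)=\sum_j z_j\overline{w_j}$, let $d\lambda$ be Lebesgue measure on $\mathbb C^d\simeq\mathbb R^{2d}$, and let $$(\Pi_A F)(z)=\pi^{-d}\int_{\mathbb C^d}F(w)\,e^{(z,w)-|w|^2}\,d\lambda(w),\qquad\text{respectively}\qquad (\Pi_A F)(z)=\pi^{-d}\langle F,\,e^{(z,\cdot)-|\cdot|^2}\rangle ,$$ when $F$ is a bounded function with compact support, respectively a compactly supported Gevrey distribution. For $t_1\le t_2$ in $\mathbb R^d_+$, $\mathcal R^\infty_{t_1,t_2}(\mathbb C^d)$ is the set of all non-negative $\chi\in L^\infty(\mathbb C^d)$ supported in $\overline{D_{t_2}(0)}$,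 such that $\chi(z)=\chi_0(|z_1|,\dots,|z_d|)$ for some function $\chi_0$, and $\chi\ge c$ on $D_{t_1}(0)$ for some constant $c>0$. For $\Omega\subseteq\mathbb C^d$ open, $\mathscr E'(\Omega)\cap L^\infty$ is the set of $F\in L^\infty(\mathbb C^d)$ with compact support contained in $\Omega$. For $s>1$, $\mathcal E_s(\Omega)$ is the Gevrey class of all smooth $\varphi$ on $\Omega\subseteq\mathbb C^d\simeq\mathbb R^{2d}$ such that for every compact $K\subseteq\Omega$ there are $h,C>0$ with $|\partial^\alpha\varphi|\le C h^{|\alpha|}\alpha!^s$ on $K$ for all multi-indices $\alpha$. Its dual $\mathcal E_s'(\Omega)$ consists of the linear functionals $u$ on $\mathcal E_s(\Omega)$ for which there is a compact $K\subseteq\Omega$ such that for every $h>0$ there is a $C$ with $$|u(\varphi)|\le C\sup_{\alpha}\sup_{x\in K}\frac{|\partial^\alpha\varphi(x)|}{h^{|\alpha|}\alpha!^s},\qquad \varphi\in\mathcal E_s(\Omega).$$ **Proposition.** Let $F\in A(\mathbb C^d)$, $s>1$ and $r\in\mathbb R^d_+$. Then the following conditions are equivalent: 1. for some $r_0\in\mathbb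 R^d_+$ with $r_0<r$ there is a constant $C$ such that $|F(z)|\le C e^{r_{0,1}|z_1|+\cdots+r_{0,d}|z_d|}$ for all $z\in\mathbb C^d$; 2. for some $t_1\in\mathbb R^d_+$ with $t_1<r$, every $t_2\in\mathbb R^d_+$ with $t_1\le t_2<r$ and every $\chi\in\mathcal R^\infty_{t_1,t_2}(\mathbb C^d)$, there exists $F_0\in A(\overline{D_r(0)})$ such that $F=\Pi_A(F_0\cdot\chi)$; 3. for some $t_1\in\mathbb R^d_+$ with $t_1<r$ and every $t_2\in\mathbb R^d_+$ with $t_1\le t_2<r$, there exist $\chi\in\mathcal R^\infty_{t_1,t_2}(\mathbb C^d)$ and $F_0\in A(\overline{D_r(0)})$ such that $F=\Pi_A(F_0\cdot\chi)$; 4. there exists $F_0\in\mathscr E'(D_r(0))\cap L^\infty(\mathbb C^d)$ such that $F=\Pi_AF_0$; 5. for some $r_0\in\mathbb R^d_+$ with $r_0<r$ there exists $F_0\in\mathcal E_s'(D_{r_0}(0))$ such that $F=\Pi_AF_0$. -/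

import Mathlib

open MeasureTheory Set
open scoped ContDiff NNReal ENNReal

/-! ### Polydiscs, functions on `ℂ^d`

`ℂ^d` is `Fin d → ℂ`, with its product Lebesgue measure `volume`. An element of `ℝ^d_+` is a vector
`r : Fin d → ℝ` with `0 < r j` for all `j`; inequalities between such vectors are componentwise. -/

/-- The open polydisc `D_r(0)`. -/
def openPolydisc {d : ℕ} (r : Fin d → ℝ) : Set (Fin d → ℂ) :=
  {z | ∀ j, ‖z j‖ < r j}

/-- The closed polydisc, which is the closure of `D_r(0)` for `r ∈ ℝ^d_+`. -/
def closedPolydisc {d : ℕ} (r : Fin d → ℝ) : Set (Fin d → ℂ) :=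
  {z | ∀ j, ‖z j‖ ≤ r j}

/-- `A(Ω)`: for `Ω` open, the functions analytic in `Ω`; for `Ω` closed, the functions analytic in
an open neighbourhood of `Ω` (being analytic at a point is an open condition). -/
def analyticFunctions {d : ℕ} (Ω : Set (Fin d → ℂ)) : Set ((Fin d → ℂ) → ℂ) :=
  {F | AnalyticOnNhd ℂ F Ω}

/-- The class `R^∞_{t₁,t₂}(ℂ^d)` of positive, bounded and radial symmetric functions. As the
members are elements of `L^∞`, all pointwise conditions are imposed almost everywhere; a function
in `L^∞` has support in a closed set exactly if it vanishes almost everywhere outside of it. -/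
structure IsPosBoundedRadial {d : ℕ} (t₁ t₂ : Fin d → ℝ) (χ : (Fin d → ℂ) → ℝ) : Prop where
  t₁_pos : ∀ j, 0 < t₁ j
  t₁_le_t₂ : ∀ j, t₁ j ≤ t₂ j
  memLp_top : MemLp χ ∞ volume
  nonneg : ∀ᵐ z, 0 ≤ χ z
  support : ∀ᵐ z, z ∉ closedPolydisc t₂ → χ z = 0
  radial : ∃ χ₀ : (Fin d → ℝ) → ℝ, ∀ᵐ z, χ z = χ₀ (fun j => ‖z j‖)
  lower_bound : ∃ c : ℝ, 0 < c ∧ ∀ᵐ z, z ∈ openPolydisc t₁ → c ≤ χ z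

/-- `E'(Ω) ∩ L^∞`, for `Ω` open: essentially bounded functions whose support is a compact subset
of `Ω`. -/
structure IsBoundedCompactlySupportedIn {d : ℕ} (Ω : Set (Fin d → ℂ)) (F : (Fin d → ℂ) → ℂ) :
    Prop where
  memLp_top : MemLp F ∞ volume
  support : ∃ K : Set (Fin d → ℂ), IsCompact K ∧ K ⊆ Ω ∧ ∀ᵐ z, z ∉ K → F z = 0

/-! ### Gevrey functions and compactly supported Gevrey distributions -/

section Gevrey

variable {E : Type*} [NormedAddCommGroup E] [NormedSpace ℝ E]

/-- `‖D^n φ(x)‖ ≤ C h^n (n!)^s` for all `n` and all `x ∈ K`. Since `α! ≤ |α|! ≤ m^{|α|} α!` for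
multi-indices in `m` variables, bounding the full derivative of order `n` instead of the partial
derivatives of order `α` by `C h^{|α|} (α!)^s` only changes `h` by a factor depending on `m`
and `s` (and the norms). -/
def GevreyBound (s : ℝ) (K : Set E) (h C : ℝ) (φ : E → ℂ) : Prop :=
  ∀ n : ℕ, ∀ x ∈ K, ‖iteratedFDeriv ℝ n φ x‖ ≤ C * h ^ n * (n.factorial : ℝ) ^ s

/-- The (Roumieu) Gevrey class `E_s(Ω)` of order `s` on an open set `Ω`: functions smooth in `Ω`
such that on every compact `K ⊆ Ω` the derivatives are bounded by `C h^n (n!)^s` for some `C` and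
`h`. The values outside `Ω` are irrelevant. -/
def gevreyFunctions (s : ℝ) (Ω : TopologicalSpace.Opens E) : Submodule ℂ (E → ℂ) where
  carrier := {φ | ContDiffOn ℝ ∞ φ Ω ∧ ∀ K : Set E, IsCompact K → K ⊆ Ω →
    ∃ h C : ℝ, 0 < h ∧ 0 ≤ C ∧ GevreyBound s K h C φ}
  add_mem' := by
    rintro φ ψ ⟨hφ, bφ⟩ ⟨hψ, bψ⟩
    refine ⟨hφ.add hψ, fun K hK hKΩ => ?_⟩
    obtain ⟨h₁, C₁, h₁p, C₁p, b₁⟩ := bφ K hK hKΩ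
    obtain ⟨h₂, C₂, h₂p, C₂p, b₂⟩ := bψ K hK hKΩ
    refine ⟨max h₁ h₂, C₁ + C₂, lt_max_of_lt_left h₁p, add_nonneg C₁p C₂p, fun n x hx => ?_⟩
    have hnb : (Ω : Set E) ∈ nhds x := Ω.isOpen.mem_nhds (hKΩ hx)
    have e : iteratedFDeriv ℝ n (φ + ψ) x = iteratedFDeriv ℝ n φ x + iteratedFDeriv ℝ n ψ x :=
      iteratedFDeriv_add_apply ((hφ.contDiffAt hnb).of_le (WithTop.coe_le_coe.2 le_top))
        ((hψ.contDiffAt hnb).of_le (WithTop.coe_le_coe.2 le_top))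
    rw [e]
    calc _ ≤ C₁ * h₁ ^ n * (n.factorial : ℝ) ^ s + C₂ * h₂ ^ n * (n.factorial : ℝ) ^ s :=
          (norm_add_le _ _).trans (add_le_add (b₁ n x hx) (b₂ n x hx))
      _ ≤ C₁ * (max h₁ h₂) ^ n * (n.factorial : ℝ) ^ s + C₂ * (max h₁ h₂) ^ n * (n.factorial : ℝ) ^ s := by
          gcongr
          · exact le_max_left _ _
          · exact le_max_right _ _
      _ = _ := by ring
  zero_mem' := by
    refine ⟨contDiffOn_const, fun K _ _ => ⟨1, 0, one_pos, le_rfl, fun n x _ => ?_⟩⟩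
    have e : iteratedFDeriv ℝ n (0 : E → ℂ) x = 0 := by
      rw [show (0 : E → ℂ) = fun _ => 0 from rfl, iteratedFDeriv_fun_zero]; rfl
    simp [e]
  smul_mem' := by
    rintro c φ ⟨hφ, bφ⟩
    refine ⟨contDiffOn_const.smul hφ, fun K hK hKΩ => ?_⟩
    obtain ⟨h, C, hp, Cp, b⟩ := bφ K hK hKΩ
    refine ⟨h, ‖c‖ * C, hp, by positivity, fun n x hx => ?_⟩
    have hnb : (Ω : Set E) ∈ nhds x := Ω.isOpen.mem_nhds (hKΩ hx)
    have e : iteratedFDeriv ℝ n (c • φ) x = c • iteratedFDeriv ℝ n φ x :=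
      iteratedFDeriv_const_smul_apply ((hφ.contDiffAt hnb).of_le (WithTop.coe_le_coe.2 le_top))
    rw [e, norm_smul]
    calc _ ≤ ‖c‖ * (C * h ^ n * (n.factorial : ℝ) ^ s) := by
          gcongr; exact b n x hx
      _ = _ := by ring

/-- `u ∈ E_s'(Ω)`: a linear functional on `E_s(Ω)` which is continuous, that is, there is a compact
`K ⊆ Ω` such that for every `h > 0` there is a `C` with
`|u(φ)| ≤ C sup_{n, x ∈ K} ‖D^n φ(x)‖ / (h^n (n!)^s)` for all `φ` (where `M` runs over the upper
bounds of the supremum). -/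
def IsGevreyDistribution {s : ℝ} {Ω : TopologicalSpace.Opens E}
    (u : gevreyFunctions s Ω →ₗ[ℂ] ℂ) : Prop :=
  ∃ K : Set E, IsCompact K ∧ K ⊆ Ω ∧ ∀ h : ℝ, 0 < h → ∃ C : ℝ,
    ∀ (φ : gevreyFunctions s Ω) (M : ℝ), 0 ≤ M → GevreyBound s K h M φ → ‖u φ‖ ≤ C * M

/-- Near each point, the derivatives of a real analytic function satisfy Cauchy estimates. -/
theorem exists_gevreyBound_nhds {f : E → ℂ} {x : E} (hf : AnalyticAt ℝ f x) :
    ∃ U ∈ nhds x, ∃ h C : ℝ, 0 < h ∧ 0 ≤ C ∧ GevreyBound 1 U h C f := by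
  obtain ⟨p, r, hp⟩ := hf
  obtain ⟨ρ, hρ0, hρ⟩ : ∃ ρ : ℝ≥0, 0 < ρ ∧ (ρ + ρ : ℝ≥0∞) < r := by
    obtain ⟨a, ha0, har⟩ := ENNReal.lt_iff_exists_nnreal_btwn.1 hp.r_pos
    refine ⟨a / 2, by simpa using ha0, ?_⟩
    rw [← ENNReal.coe_add, add_halves]
    exact har
  have hsum := p.changeOriginSeries_summable_aux₁ (hρ.trans_le hp.r_le)
  have hρ' : (0 : ℝ) < ρ := hρ0
  set S : ℝ≥0 := ∑' s : Σ k l : ℕ, { s : Finset (Fin (k + l)) // s.card = l },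
    ‖p (s.1 + s.2.1)‖₊ * ρ ^ s.2.1 * ρ ^ s.1 with hS
  refine ⟨Metric.closedBall x ρ, Metric.closedBall_mem_nhds x hρ', (ρ : ℝ)⁻¹, S,
    inv_pos.2 hρ', S.2, fun n w hw => ?_⟩
  obtain ⟨y, rfl⟩ : ∃ y, w = x + y := ⟨w - x, by abel⟩
  have hy : ‖y‖₊ ≤ ρ := by
    have : ‖y‖ ≤ ρ := by simpa [Metric.mem_closedBall, dist_eq_norm] using hw
    exact this
  have hρr : (ρ : ℝ≥0∞) < r := lt_of_le_of_lt le_self_add hρ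
  have hyr : (‖y‖₊ : ℝ≥0∞) < r := lt_of_le_of_lt (by exact_mod_cast hy) hρr
  have hq := hp.changeOrigin hyr
  have hco : ‖p.changeOrigin y n‖₊ * ρ ^ n ≤ S := by
    have h1 := p.nnnorm_changeOrigin_le n (hyr.trans_le hp.r_le)
    have hs2 := p.changeOriginSeries_summable_aux₂ (hρr.trans_le hp.r_le) n
    have h2 : ‖p.changeOrigin y n‖₊ ≤
        ∑' s : Σ l : ℕ, { s : Finset (Fin (n + l)) // s.card = l }, ‖p (n + s.1)‖₊ * ρ ^ s.1 := by
      refine h1.trans ((NNReal.summable_of_le (fun s => ?_) hs2).tsum_le_tsum (fun s => ?_) hs2)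
      · gcongr
      · gcongr
    calc _ ≤ (∑' s : Σ l : ℕ, { s : Finset (Fin (n + l)) // s.card = l },
          ‖p (n + s.1)‖₊ * ρ ^ s.1) * ρ ^ n := by gcongr
      _ = ∑' s : Σ l : ℕ, { s : Finset (Fin (n + l)) // s.card = l },
          ‖p (n + s.1)‖₊ * ρ ^ s.1 * ρ ^ n := NNReal.tsum_mul_right _ _ |>.symm
      _ ≤ S := NNReal.tsum_comp_le_tsum_of_inj hsum (i := fun s => ⟨n, s⟩)
            (fun a b hab => by simpa using hab)
  have hco' : ‖p.changeOrigin y n‖ ≤ S * (ρ : ℝ)⁻¹ ^ n := by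
    rw [inv_pow, ← div_eq_mul_inv, le_div_iff₀ (by positivity)]
    exact_mod_cast hco
  rw [Real.rpow_one]
  refine ContinuousMultilinearMap.opNorm_le_bound (by positivity) fun v => ?_
  rw [hq.iteratedFDeriv_eq_sum_of_completeSpace]
  calc _ ≤ ∑ σ : Equiv.Perm (Fin n), ‖p.changeOrigin y n (fun i => v (σ i))‖ := norm_sum_le _ _
    _ ≤ ∑ _σ : Equiv.Perm (Fin n), ‖p.changeOrigin y n‖ * ∏ i, ‖v i‖ := by
        refine Finset.sum_le_sum fun σ _ => ?_
        refine ((p.changeOrigin y n).le_opNorm _).trans_eq ?_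
        rw [Equiv.prod_comp σ (fun i => ‖v i‖)]
    _ = ‖p.changeOrigin y n‖ * n.factorial * ∏ i, ‖v i‖ := by
        rw [Finset.sum_const, Finset.card_univ, Fintype.card_perm, Fintype.card_fin, nsmul_eq_mul]
        ring
    _ ≤ _ := by gcongr

/-- Real analytic functions belong to `E_s(Ω)` for `s ≥ 1`. -/
theorem mem_gevreyFunctions_of_analytic {s : ℝ} (hs : 1 ≤ s) (Ω : TopologicalSpace.Opens E)
    {f : E → ℂ} (hf : AnalyticOnNhd ℝ f univ) : f ∈ gevreyFunctions s Ω := by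
  refine ⟨fun x _ => ((hf x (mem_univ x)).contDiffAt).contDiffWithinAt, fun K hK _ => ?_⟩
  have key : ∃ h C : ℝ, 0 < h ∧ 0 ≤ C ∧ GevreyBound 1 K h C f := by
    refine hK.induction_on (p := fun K => ∃ h C : ℝ, 0 < h ∧ 0 ≤ C ∧ GevreyBound 1 K h C f)
      ⟨1, 0, one_pos, le_rfl, fun _ _ hx => hx.elim⟩ ?_ ?_ ?_
    · rintro A B hAB ⟨h, C, hh, hC, b⟩
      exact ⟨h, C, hh, hC, fun n x hx => b n x (hAB hx)⟩
    · rintro A B ⟨h₁, C₁, hh₁, hC₁, b₁⟩ ⟨h₂, C₂, hh₂, hC₂, b₂⟩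
      refine ⟨max h₁ h₂, max C₁ C₂, lt_max_of_lt_left hh₁, le_max_of_le_left hC₁, ?_⟩
      rintro n x (hx | hx)
      · refine (b₁ n x hx).trans ?_
        gcongr
        · exact le_max_left _ _
        · exact le_max_left _ _
      · refine (b₂ n x hx).trans ?_
        gcongr
        · exact le_max_right _ _
        · exact le_max_right _ _
    · intro x _
      obtain ⟨U, hU, h⟩ := exists_gevreyBound_nhds (hf x (mem_univ x))
      exact ⟨U, mem_nhdsWithin_of_mem_nhds hU, h⟩
  obtain ⟨h, C, hh, hC, b⟩ := key
  refine ⟨h, C, hh, hC, fun n x hx => (b n x hx).trans ?_⟩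
  have : (1 : ℝ) ≤ n.factorial := by exact_mod_cast Nat.factorial_pos n
  gcongr

end Gevrey

/-! ### The operator `Π_A` -/

/-- `w ↦ e^{(z,w) - |w|²}`, where `(z,w) = ∑ z_j \bar w_j` and `|w|² = ∑ |w_j|²`. -/
noncomputable def bargmannKernel {d : ℕ} (z w : Fin d → ℂ) : ℂ :=
  Complex.exp (∑ j, z j * (starRingEnd ℂ) (w j) - ((∑ j, ‖w j‖ ^ 2 : ℝ) : ℂ))

/-- `Π_A F(z) = π^{-d} ∫ F(w) e^{(z,w) - |w|²} dλ(w)` for functions `F`. -/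
noncomputable def bargmannProj {d : ℕ} (F : (Fin d → ℂ) → ℂ) (z : Fin d → ℂ) : ℂ :=
  ((Real.pi : ℂ) ^ d)⁻¹ * ∫ w, F w * bargmannKernel z w

theorem analyticOnNhd_bargmannKernel {d : ℕ} (z : Fin d → ℂ) :
    AnalyticOnNhd ℝ (bargmannKernel z) univ := by
  have hproj : ∀ j : Fin d, AnalyticOnNhd ℝ (fun w : Fin d → ℂ => w j) univ := fun j =>
    (ContinuousLinearMap.proj (R := ℝ) (φ := fun _ : Fin d => ℂ) j).analyticOnNhd _
  have hconj : ∀ j : Fin d, AnalyticOnNhd ℝ (fun w : Fin d → ℂ => (starRingEnd ℂ) (w j)) univ :=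
    fun j => ((Complex.conjCLE : ℂ →L[ℝ] ℂ).comp
      (ContinuousLinearMap.proj (R := ℝ) (φ := fun _ : Fin d => ℂ) j)).analyticOnNhd _
  have e : bargmannKernel z = fun w : Fin d → ℂ =>
      Complex.exp (∑ j, (z j * (starRingEnd ℂ) (w j) - w j * (starRingEnd ℂ) (w j))) := by
    funext w
    simp only [bargmannKernel, Complex.mul_conj, Complex.normSq_eq_norm_sq]
    push_cast
    rw [Finset.sum_sub_distrib]
  rw [e]
  intro w hw
  refine (analyticAt_cexp.restrictScalars (𝕜 := ℝ)).fun_comp ?_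
  refine Finset.analyticAt_fun_sum _ fun j _ => ?_
  exact (analyticAt_const.mul (hconj j w hw)).sub ((hproj j w hw).mul (hconj j w hw))

/-- `Π_A u(z) = π^{-d} ⟨u, e^{(z,·) - |·|²}⟩` for Gevrey distributions `u` with compact support. -/
noncomputable def bargmannProjGevrey {d : ℕ} {s : ℝ} (hs : 1 ≤ s)
    {Ω : TopologicalSpace.Opens (Fin d → ℂ)} (u : gevreyFunctions s Ω →ₗ[ℂ] ℂ)
    (z : Fin d → ℂ) : ℂ :=
  ((Real.pi : ℂ) ^ d)⁻¹ *
    u ⟨bargmannKernel z, mem_gevreyFunctions_of_analytic hs Ω (analyticOnNhd_bargmannKernel z)⟩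

/-- The open polydisc as a bundled open set. -/
def openPolydiscOpens {d : ℕ} (r : Fin d → ℝ) : TopologicalSpace.Opens (Fin d → ℂ) where
  carrier := openPolydisc r
  is_open' := by
    rw [openPolydisc, Set.ofPred_forall]
    exact isOpen_iInter_of_finite fun j =>
      isOpen_lt (continuous_apply j).norm continuous_const

/-! ### Sums over multi-indices -/

/-! The implications are proved in a cycle 1 → 2 → 3 → 4 → 5 → 1, and the analytic content sits in 1
→ 2 and 5 → 1.

For 1 → 2, monomials are orthogonal for the radial weight `χ e^{-|w|²}`, so `Π_A` is diagonal on
power series: it sends `w^α χ` to `m_α z^α / (π^d α!)`, where `m_α = ∫ ∏ |w_j|^{2α_j} χ e^{-|w|²}`.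
Thus if `F = ∑ a_α z^α`, one takes `F₀ = ∑ c_α w^α` with `c_α = π^d α! a_α / m_α`. Exponential type
`r₀` gives `|a_α| α! ≲ ∏ (α_j + 1) r₀_j^{α_j}` by Cauchy's estimates
(`exists_hasSum_of_exponential_type`), and `χ ≥ c` on `D_{t₁}(0)` gives `m_α ≥ κ ∏ τ_j^{2α_j}` for
each `τ < t₁` (`exists_moment`). The series for `F₀` therefore converges on `D_ρ(0)` whenever `r₀_j
ρ_j < τ_j²`. Since `r₀ < r`, one can choose `τ < t₁ < r` with `τ_j² > r₀_j r_j`, which leaves room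
for `ρ > r` (`exists_radii`).

For 5 → 1, `n` derivatives of `e^{(z,w)}` in `w` cost at most `(∑ |z_j|)^n ≤ n! ε^{-n} e^{ε ∑
|z_j|}`. A Gevrey seminorm of the kernel with one fixed `h` is then `O(e^{∑ (r₀_j + ε)|z_j|})`, and
`ε` is chosen with `r₀ + ε < r`.

For the rest, an indicator function is an admissible weight, `F₀ χ` is bounded with compact support,
and such a function acts on test functions by integration. -/

theorem summable_norm_and_hasSum_prod_pi {R : Type*} [NormedField R] [CompleteSpace R] :
    ∀ {d : ℕ} (f : Fin d → ℕ → R), (∀ j, Summable fun n => ‖f j n‖) →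
      Summable (fun α : Fin d → ℕ => ‖∏ j, f j (α j)‖) ∧
        HasSum (fun α : Fin d → ℕ => ∏ j, f j (α j)) (∏ j, ∑' n, f j n) := by
  intro d
  induction d with
  | zero =>
    intro f _
    refine ⟨Summable.of_finite, ?_⟩
    simp
  | succ d ih =>
    intro f hf
    obtain ⟨h1, h2⟩ := ih (fun j => f j.succ) fun j => hf j.succ
    have h0 := hf 0
    have e : ∀ p : ℕ × (Fin d → ℕ),
        ∏ j, f j ((Fin.consEquiv fun _ : Fin (d + 1) => ℕ) p j) =
          f 0 p.1 * ∏ j, f j.succ (p.2 j) := fun p => by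
      rw [Fin.prod_univ_succ]
      simp [Fin.consEquiv]
    constructor
    · rw [← (Fin.consEquiv fun _ : Fin (d + 1) => ℕ).summable_iff]
      refine (h0.mul_norm h1).congr fun p => ?_
      rw [Function.comp_apply, e]
    · rw [← (Fin.consEquiv fun _ : Fin (d + 1) => ℕ).hasSum_iff, Fin.prod_univ_succ, ← h2.tsum_eq]
      simp only [Function.comp_def, e]
      rw [tsum_mul_tsum_of_summable_norm h0 h1]
      exact (summable_mul_of_summable_norm h0 h1).hasSum

theorem summable_prod_pi {d : ℕ} (f : Fin d → ℕ → ℝ) (hf : ∀ j, Summable (f j)) :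
    Summable fun α : Fin d → ℕ => ∏ j, f j (α j) :=
  (summable_norm_and_hasSum_prod_pi f fun j => (hf j).norm).2.summable

/-! ### Power series expansion of entire functions of exponential type -/

/-- A weak Stirling bound. The induction step is `((n+2)/(n+1))^{n+2} ≥ e`, obtained from `1 - x ≤
e^{-x}` at `x = 1/(n+2)`. -/
theorem factorial_mul_exp_le (n : ℕ) :
    (n.factorial : ℝ) * Real.exp n ≤ ((n : ℝ) + 1) ^ (n + 1) := by
  induction n with
  | zero => simp
  | succ n ih =>
    have h1 : ((n : ℝ) + 1) / (n + 2) ≤ Real.exp (-(1 / ((n : ℝ) + 2))) := by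
      refine le_trans (le_of_eq ?_) (Real.add_one_le_exp _)
      field_simp
      ring
    have h2 : (((n : ℝ) + 1) / (n + 2)) ^ (n + 2) ≤ Real.exp (-1) := by
      refine (pow_le_pow_left₀ (by positivity) h1 _).trans_eq ?_
      rw [← Real.exp_nat_mul]
      congr 1
      push_cast
      field_simp
    rw [div_pow, div_le_iff₀ (by positivity), Real.exp_neg, inv_mul_eq_div,
      le_div_iff₀ (Real.exp_pos 1)] at h2
    rw [Nat.factorial_succ]
    push_cast
    rw [Real.exp_add]
    calc ((n : ℝ) + 1) * n.factorial * (Real.exp n * Real.exp 1)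
        = (n.factorial * Real.exp n) * ((n + 1) * Real.exp 1) := by ring
      _ ≤ ((n : ℝ) + 1) ^ (n + 1) * ((n + 1) * Real.exp 1) := by gcongr
      _ = ((n : ℝ) + 1) ^ (n + 2) * Real.exp 1 := by ring
      _ ≤ _ := h2.trans_eq (by ring)

/-- The bound for the `n`-th Taylor coefficient of a function bounded by `exp (ρ |z|)`. -/
noncomputable def taylorBound (ρ : ℝ) (n : ℕ) : ℝ :=
  Real.exp 1 * (n + 1) * ρ ^ n / n.factorial

theorem norm_taylorCoeff_le {g : ℂ → ℂ} (hg : Differentiable ℂ g) {ρ B : ℝ} (hρ : 0 < ρ)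
    (hb : ∀ z, ‖g z‖ ≤ B * Real.exp (ρ * ‖z‖)) (n : ℕ) :
    ‖(n.factorial : ℂ)⁻¹ * iteratedDeriv n g 0‖ ≤ B * taylorBound ρ n := by
  have hB : 0 ≤ B := by simpa using (norm_nonneg _).trans (hb 0)
  -- Cauchy's estimate is applied on the circle of radius `(n+1)/ρ`. The near-optimal `n/ρ` would
  -- degenerate at `n = 0`; the shift costs the factor `e (n+1)` in `taylorBound`.
  have hR : 0 < ((n : ℝ) + 1) / ρ := by positivity
  have h := Complex.norm_iteratedDeriv_le_of_forall_mem_sphere_norm_le (f := g) (c := 0) n hR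
    hg.diffContOnCl (C := B * Real.exp (n + 1)) fun z hz => by
      have : ‖z‖ = ((n : ℝ) + 1) / ρ := by simpa using hz
      refine (hb z).trans_eq ?_
      rw [this]
      field_simp
  have hn : (0 : ℝ) < n.factorial := by exact_mod_cast n.factorial_pos
  rw [norm_mul, norm_inv, Complex.norm_natCast, inv_mul_le_iff₀ hn]
  refine h.trans ?_
  rw [taylorBound, div_pow, Real.exp_add]
  have h2 := factorial_mul_exp_le n
  have e1 : (n.factorial : ℝ) * (B * (Real.exp n * Real.exp 1)) / (((n : ℝ) + 1) ^ n / ρ ^ n) =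
      (n.factorial * Real.exp n) * (B * Real.exp 1 * ρ ^ n / ((n : ℝ) + 1) ^ n) := by
    field_simp
  have e2 : (n.factorial : ℝ) * (B * (Real.exp 1 * (n + 1) * ρ ^ n / n.factorial)) =
      ((n : ℝ) + 1) ^ (n + 1) * (B * Real.exp 1 * ρ ^ n / ((n : ℝ) + 1) ^ n) := by
    rw [pow_succ]
    field_simp
  rw [e1, e2]
  gcongr

theorem taylorBound_nonneg {ρ : ℝ} (hρ : 0 ≤ ρ) (n : ℕ) : 0 ≤ taylorBound ρ n := by
  unfold taylorBound
  positivity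

theorem summable_taylorBound_mul_pow (ρ x : ℝ) : Summable fun n => taylorBound ρ n * x ^ n := by
  have h1 : Summable fun n : ℕ => (2 * (ρ * x)) ^ n / n.factorial :=
    Real.summable_pow_div_factorial _
  refine Summable.of_norm_bounded (g := fun n => Real.exp 1 * ‖(2 * (ρ * x)) ^ n / n.factorial‖)
    (h1.norm.mul_left _) fun n => ?_
  have h2 : ((n : ℝ) + 1) ≤ 2 ^ n := by exact_mod_cast Nat.lt_two_pow_self
  have e : taylorBound ρ n * x ^ n =
      Real.exp 1 * ((n + 1) * ((ρ * x) ^ n / n.factorial)) := by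
    rw [taylorBound, mul_pow]
    ring
  have e' : (2 * (ρ * x)) ^ n / n.factorial = 2 ^ n * ((ρ * x) ^ n / n.factorial) := by
    rw [mul_pow]
    ring
  rw [e, e', norm_mul, norm_mul, norm_mul, Real.norm_of_nonneg (Real.exp_pos 1).le,
    Real.norm_of_nonneg (by positivity : (0 : ℝ) ≤ n + 1),
    Real.norm_of_nonneg (by positivity : (0 : ℝ) ≤ 2 ^ n)]
  gcongr

theorem analyticOnNhd_fin_cons {d : ℕ} (t : ℂ) (s : Set (Fin d → ℂ)) :
    AnalyticOnNhd ℂ (fun w : Fin d → ℂ => (Fin.cons t w : Fin (d + 1) → ℂ)) s := by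
  refine fun w _ => AnalyticAt.pi fun j => ?_
  refine Fin.cases ?_ (fun j => ?_) j
  · simpa using analyticAt_const
  · exact (ContinuousLinearMap.proj (R := ℂ) (φ := fun _ : Fin d => ℂ) j).analyticAt w

theorem hasDerivAt_fin_cons {d : ℕ} (t : ℂ) (w : Fin d → ℂ) :
    HasDerivAt (fun t : ℂ => (Fin.cons t w : Fin (d + 1) → ℂ)) (Fin.cons 1 0) t := by
  refine hasDerivAt_pi.2 fun j => ?_
  refine Fin.cases ?_ (fun j => ?_) j
  · exact hasDerivAt_id t
  · exact hasDerivAt_const t (w j)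

/-- Differentiating along the first coordinate replaces `F` by the entire function `z ↦ DF(z) e₀`,
so the induction on `n` has to let `F` vary. -/
theorem analyticOnNhd_iteratedDeriv_fin_cons {d : ℕ} (n : ℕ) :
    ∀ {F : (Fin (d + 1) → ℂ) → ℂ}, AnalyticOnNhd ℂ F univ →
      AnalyticOnNhd ℂ (fun w : Fin d → ℂ =>
        iteratedDeriv n (fun t => F (Fin.cons t w)) 0) univ := by
  induction n with
  | zero =>
    intro F hF
    simp only [iteratedDeriv_zero]
    exact fun w _ => (hF _ (mem_univ _)).comp (analyticOnNhd_fin_cons 0 univ w (mem_univ _))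
  | succ n ih =>
    intro F hF
    have hG : AnalyticOnNhd ℂ (fun z => fderiv ℂ F z (Fin.cons 1 0)) univ := fun z hz =>
      (ContinuousLinearMap.apply ℂ ℂ (Fin.cons 1 0 : Fin (d + 1) → ℂ)).analyticAt _ |>.comp
        (hF.fderiv z hz)
    have e : ∀ w : Fin d → ℂ, deriv (fun t => F (Fin.cons t w)) =
        fun t => fderiv ℂ F (Fin.cons t w) (Fin.cons 1 0) := fun w => funext fun t =>
      ((hF _ (mem_univ _)).differentiableAt.hasFDerivAt.comp_hasDerivAt t
        (hasDerivAt_fin_cons t w)).deriv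
    simp only [iteratedDeriv_succ', e]
    exact ih hG

/-- Induction on `d`. The `n`-th Taylor coefficient in the first variable is entire in the others
and, by the one-variable estimate, of the same type there with constant `C * taylorBound (ρ 0) n`.
The resulting product bounds make the multiple series absolutely summable, so it may be summed one
variable at a time. -/
theorem exists_hasSum_of_exponential_type : ∀ {d : ℕ} {ρ : Fin d → ℝ} (_ : ∀ j, 0 < ρ j)
    {F : (Fin d → ℂ) → ℂ} (_ : AnalyticOnNhd ℂ F univ) {C : ℝ}
    (_ : ∀ z, ‖F z‖ ≤ C * Real.exp (∑ j, ρ j * ‖z j‖)),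
    ∃ a : (Fin d → ℕ) → ℂ, (∀ α, ‖a α‖ ≤ C * ∏ j, taylorBound (ρ j) (α j)) ∧
      ∀ z, HasSum (fun α => a α * ∏ j, z j ^ α j) (F z) := by
  intro d
  induction d with
  | zero =>
    intro ρ _ F _ C hC
    refine ⟨fun _ => F 0, fun α => by simpa using hC 0, fun z => ?_⟩
    rw [Subsingleton.elim z 0]
    simp
  | succ d ih =>
    intro ρ hρ F hF C hC
    have hC0 : 0 ≤ C := by simpa using (norm_nonneg _).trans (hC 0)
    have hline : ∀ w : Fin d → ℂ, Differentiable ℂ fun t : ℂ => F (Fin.cons t w) := fun w t =>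
      ((hF _ (mem_univ _)).differentiableAt).comp t (hasDerivAt_fin_cons t w).differentiableAt
    have hcoef : ∀ n, ∃ a : (Fin d → ℕ) → ℂ,
        (∀ α, ‖a α‖ ≤ C * taylorBound (ρ 0) n * ∏ j, taylorBound (ρ j.succ) (α j)) ∧
        ∀ z, HasSum (fun α => a α * ∏ j, z j ^ α j)
          ((n.factorial : ℂ)⁻¹ * iteratedDeriv n (fun t => F (Fin.cons t z)) 0) := fun n => by
      refine ih (ρ := fun j => ρ j.succ) (fun j => hρ _) (fun z hz => analyticAt_const.mul
        (analyticOnNhd_iteratedDeriv_fin_cons n hF z hz)) fun z => ?_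
      refine (norm_taylorCoeff_le (hline z) (hρ 0)
        (B := C * Real.exp (∑ j : Fin d, ρ j.succ * ‖z j‖)) (fun t => ?_) n).trans_eq (by ring)
      refine (hC _).trans_eq ?_
      rw [Fin.sum_univ_succ, Real.exp_add]
      simp only [Fin.cons_zero, Fin.cons_succ]
      ring
    choose a ha hs using hcoef
    refine ⟨fun α => a (α 0) (Fin.tail α), fun α => ?_, fun z => ?_⟩
    · refine (ha _ _).trans_eq ?_
      rw [Fin.prod_univ_succ, mul_assoc]
      rfl
    · have hsum : Summable fun α : Fin (d + 1) → ℕ =>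
          a (α 0) (Fin.tail α) * ∏ j, z j ^ α j := by
        refine Summable.of_norm_bounded (((summable_prod_pi
          (fun j n => taylorBound (ρ j) n * ‖z j‖ ^ n)
          fun j => summable_taylorBound_mul_pow _ _)).mul_left C) fun α => ?_
        rw [norm_mul, norm_prod, Finset.prod_mul_distrib, ← mul_assoc]
        simp only [norm_pow]
        gcongr
        refine (ha _ _).trans_eq ?_
        rw [Fin.prod_univ_succ, mul_assoc]
        rfl
      have hz := Complex.hasSum_taylorSeries_of_entire (hline (Fin.tail z)) 0 (z 0)
      rw [Fin.cons_self_tail] at hz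
      rw [← (Fin.consEquiv fun _ : Fin (d + 1) => ℕ).hasSum_iff]
      rw [← (Fin.consEquiv fun _ : Fin (d + 1) => ℕ).summable_iff] at hsum
      refine hsum.hasSum_iff.2 ?_
      rw [hsum.tsum_prod, ← hz.tsum_eq]
      refine tsum_congr fun n => ?_
      have h := ((hs n (Fin.tail z)).mul_left (z 0 ^ n)).tsum_eq
      rw [sub_zero, smul_eq_mul, smul_eq_mul, mul_left_comm, ← h]
      refine tsum_congr fun β => ?_
      simp only [Function.comp_apply, Fin.consEquiv, Equiv.coe_fn_mk, Fin.cons_zero, Fin.tail_cons,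
        Fin.prod_univ_succ, Fin.cons_succ]
      simp only [Fin.tail]
      ring

/-! ### Analyticity of multiple power series -/

/-- The `n` slots are split into blocks of sizes `α j`, and every slot in block `j` reads off the
`j`-th coordinate. -/
theorem exists_monomial_multilinear {d n : ℕ} (α : Fin d → ℕ) (h : ∑ j, α j = n) :
    ∃ M : ContinuousMultilinearMap ℂ (fun _ : Fin n => Fin d → ℂ) ℂ, ‖M‖ ≤ 1 ∧
      ∀ y : Fin d → ℂ, M (fun _ => y) = ∏ j, y j ^ α j := by
  subst h
  refine ⟨(ContinuousMultilinearMap.mkPiAlgebra ℂ (Fin (∑ j, α j)) ℂ).compContinuousLinearMap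
    fun i => ContinuousLinearMap.proj (finSigmaFinEquiv.symm i).1, ?_, fun y => ?_⟩
  · refine ContinuousMultilinearMap.opNorm_le_bound zero_le_one fun m => ?_
    simp only [ContinuousMultilinearMap.compContinuousLinearMap_apply,
      ContinuousMultilinearMap.mkPiAlgebra_apply, ContinuousLinearMap.proj_apply, norm_prod, one_mul]
    exact Finset.prod_le_prod (fun _ _ => norm_nonneg _) fun i _ => norm_le_pi_norm _ _
  · simp only [ContinuousMultilinearMap.compContinuousLinearMap_apply,
      ContinuousMultilinearMap.mkPiAlgebra_apply, ContinuousLinearMap.proj_apply]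
    rw [← finSigmaFinEquiv.prod_comp, Fintype.prod_sigma]
    simp

/-- Grouping monomials by total degree gives a formal multilinear series whose terms are all bounded
by `∑ ‖b α‖`, so its radius is at least `1`. For the sup norm the unit ball is the unit polydisc. -/
theorem analyticOnNhd_tsum_monomial_ball {d : ℕ} {b : (Fin d → ℕ) → ℂ}
    (hb : Summable fun α => ‖b α‖) :
    AnalyticOnNhd ℂ (fun y : Fin d → ℂ => ∑' α, b α * ∏ j, y j ^ α j) (Metric.ball 0 1) := by
  choose M hM1 hM2 using fun (n : ℕ) (α : Fin d → ℕ) (h : ∑ j, α j = n) =>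
    exists_monomial_multilinear α h
  let p : FormalMultilinearSeries ℂ (Fin d → ℂ) ℂ := fun n =>
    ∑ α : Finset.Nat.antidiagonalTuple d n,
      b α • M n α (Finset.Nat.mem_antidiagonalTuple.1 α.2)
  have hp : HasFPowerSeriesOnBall (fun y : Fin d → ℂ => ∑' α, b α * ∏ j, y j ^ α j) p 0 1 := by
    refine ⟨?_, one_pos, fun {y} hy => ?_⟩
    · refine p.le_radius_of_bound (r := 1) (∑' α, ‖b α‖) fun n => ?_
      rw [NNReal.coe_one, one_pow, mul_one]
      calc ‖p n‖ ≤ ∑ α : Finset.Nat.antidiagonalTuple d n, ‖b α‖ := by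
            refine norm_sum_le_of_le _ fun α _ => ?_
            rw [norm_smul]
            exact mul_le_of_le_one_right (norm_nonneg _) (hM1 _ _ _)
        _ = ∑ α ∈ Finset.Nat.antidiagonalTuple d n, ‖b α‖ :=
            Finset.sum_coe_sort (Finset.Nat.antidiagonalTuple d n) fun α => ‖b α‖
        _ ≤ _ := hb.sum_le_tsum _ fun _ _ => norm_nonneg _
    · have hy1 : ∀ j, ‖y j‖ ≤ 1 := fun j => by
        have : ‖y‖ < 1 := by
          rwa [mem_eball_zero_iff, ← ofReal_norm, ENNReal.ofReal_lt_one] at hy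
        exact (norm_le_pi_norm y j).trans this.le
      have hs : Summable fun α : Fin d → ℕ => b α * ∏ j, y j ^ α j := by
        refine Summable.of_norm_bounded hb fun α => ?_
        rw [norm_mul, norm_prod]
        refine mul_le_of_le_one_right (norm_nonneg _) ?_
        refine Finset.prod_le_one (fun _ _ => norm_nonneg _) fun j _ => ?_
        rw [norm_pow]
        exact pow_le_one₀ (norm_nonneg _) (hy1 j)
      have h := (Finset.Nat.sigmaAntidiagonalTupleEquivTuple d).hasSum_iff.2 hs.hasSum
      have h2 := h.sigma (g := fun n => p n fun _ => y) fun n => by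
        have e : (p n fun _ => y) = ∑ α : Finset.Nat.antidiagonalTuple d n,
            b α * ∏ j, y j ^ (α : Fin d → ℕ) j := by
          simp only [p, sum_apply, smul_apply,
            hM2, smul_eq_mul]
        rw [e]
        exact hasSum_fintype _
      simpa using h2
  intro y hy
  refine hp.analyticAt_of_mem ?_
  rwa [mem_eball_zero_iff, ← ofReal_norm, ENNReal.ofReal_lt_one, ← mem_ball_zero_iff]

/-- A power series which converges absolutely at a point of `ℝ^d_+` is analytic in the
corresponding open polydisc. -/
theorem analyticOnNhd_tsum_monomial {d : ℕ} {ρ : Fin d → ℝ} (hρ : ∀ j, 0 < ρ j)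
    {c : (Fin d → ℕ) → ℂ} (hc : Summable fun α => ‖c α‖ * ∏ j, ρ j ^ α j) :
    AnalyticOnNhd ℂ (fun y : Fin d → ℂ => ∑' α, c α * ∏ j, y j ^ α j) (openPolydisc ρ) := by
  have hb : Summable fun α => ‖c α * ∏ j, (ρ j : ℂ) ^ α j‖ := by
    refine hc.congr fun α => ?_
    rw [norm_mul, norm_prod]
    simp [abs_of_pos (hρ _)]
  have hL : AnalyticOnNhd ℂ (fun y : Fin d → ℂ => fun j => (ρ j : ℂ)⁻¹ * y j) univ := fun y _ =>
    AnalyticAt.pi fun j => analyticAt_const.mul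
      ((ContinuousLinearMap.proj (R := ℂ) (φ := fun _ : Fin d => ℂ) j).analyticAt y)
  have e : (fun y : Fin d → ℂ => ∑' α, c α * ∏ j, y j ^ α j) =
      (fun y => ∑' α, (c α * ∏ j, (ρ j : ℂ) ^ α j) * ∏ j, y j ^ α j) ∘
        fun y : Fin d → ℂ => fun j => (ρ j : ℂ)⁻¹ * y j := by
    funext y
    refine tsum_congr fun α => ?_
    rw [mul_assoc, ← Finset.prod_mul_distrib]
    congr 1
    refine Finset.prod_congr rfl fun j _ => ?_
    have : (ρ j : ℂ) ≠ 0 := by exact_mod_cast (hρ j).ne'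
    rw [← mul_pow, mul_inv_cancel_left₀ this]
  rw [e]
  intro y hy
  refine (analyticOnNhd_tsum_monomial_ball hb _ ?_).comp (hL y (mem_univ _))
  rw [mem_ball_zero_iff, pi_norm_lt_iff one_pos]
  intro j
  rw [norm_mul, norm_inv, Complex.norm_real, Real.norm_eq_abs, abs_of_pos (hρ j),
    inv_mul_lt_iff₀ (hρ j), mul_one]
  exact hy j

/-! ### Gevrey estimates for the kernel -/

/-- The derivative of `exp ∘ L` is `T ∘ exp ∘ L` with `T c = c • L` and `‖T‖ ≤ ‖L‖`, so each
derivative costs one factor `‖L‖`. -/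
theorem norm_iteratedFDeriv_cexp_clm_le {E : Type*} [NormedAddCommGroup E] [NormedSpace ℝ E]
    (L : E →L[ℝ] ℂ) (n : ℕ) (x : E) :
    ‖iteratedFDeriv ℝ n (fun y => Complex.exp (L y)) x‖ ≤ ‖L‖ ^ n * ‖Complex.exp (L x)‖ := by
  induction n with
  | zero => simp
  | succ n ih =>
    have hc : ContDiff ℝ ∞ fun y => Complex.exp (L y) :=
      Complex.contDiff_exp.comp L.contDiff
    let T : ℂ →L[ℝ] E →L[ℝ] ℂ := (ContinuousLinearMap.compL ℝ E ℂ ℂ).flip L ∘L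
      ContinuousLinearMap.mul ℝ ℂ
    have hT : ‖T‖ ≤ ‖L‖ := ContinuousLinearMap.opNorm_le_bound _ (norm_nonneg _) fun c =>
      ContinuousLinearMap.opNorm_le_bound _ (by positivity) fun y => by
        change ‖c * L y‖ ≤ _
        rw [norm_mul, mul_right_comm, mul_comm]
        gcongr
        exact L.le_opNorm y
    have e : fderiv ℝ (fun y => Complex.exp (L y)) = T ∘ fun y => Complex.exp (L y) := by
      funext y
      rw [(L.hasFDerivAt.cexp).fderiv]
      ext v
      simp [T]
    rw [← norm_iteratedFDeriv_fderiv, e]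
    refine (T.norm_iteratedFDeriv_comp_left hc.contDiffAt (by exact_mod_cast le_top)).trans ?_
    calc _ ≤ ‖L‖ * (‖L‖ ^ n * ‖Complex.exp (L x)‖) := by gcongr
      _ = _ := by ring

/-- The form `w ↦ (z,w)`. -/
noncomputable def conjPairing {d : ℕ} (z : Fin d → ℂ) : (Fin d → ℂ) →L[ℝ] ℂ :=
  ∑ j, (ContinuousLinearMap.mul ℝ ℂ (z j)).comp ((Complex.conjCLE : ℂ →L[ℝ] ℂ).comp
    (ContinuousLinearMap.proj (R := ℝ) (φ := fun _ : Fin d => ℂ) j))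

theorem conjPairing_apply {d : ℕ} (z w : Fin d → ℂ) :
    conjPairing z w = ∑ j, z j * (starRingEnd ℂ) (w j) := by
  simp [conjPairing]

theorem norm_conjPairing_le {d : ℕ} (z : Fin d → ℂ) : ‖conjPairing z‖ ≤ ∑ j, ‖z j‖ := by
  refine ContinuousLinearMap.opNorm_le_bound _ (by positivity) fun w => ?_
  rw [conjPairing_apply, Finset.sum_mul]
  refine norm_sum_le_of_le _ fun j _ => ?_
  rw [norm_mul, RCLike.norm_conj]
  gcongr
  exact norm_le_pi_norm w j

theorem norm_exp_conjPairing_le {d : ℕ} {z w : Fin d → ℂ} {r : Fin d → ℝ}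
    (hw : w ∈ closedPolydisc r) :
    ‖Complex.exp (conjPairing z w)‖ ≤ Real.exp (∑ j, r j * ‖z j‖) := by
  refine (Complex.norm_exp_le_exp_norm _).trans (Real.exp_le_exp.2 ?_)
  rw [conjPairing_apply]
  refine norm_sum_le_of_le _ fun j _ => ?_
  rw [norm_mul, RCLike.norm_conj, mul_comm]
  gcongr
  exact hw j

theorem bargmannKernel_eq_mul {d : ℕ} (z w : Fin d → ℂ) :
    bargmannKernel z w = Complex.exp (conjPairing z w) * bargmannKernel 0 w := by
  rw [conjPairing_apply, bargmannKernel, bargmannKernel, ← Complex.exp_add]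
  congr 1
  simp
  ring

theorem pow_le_factorial_mul_exp {x h : ℝ} (hx : 0 ≤ x) (hh : 0 < h) (n : ℕ) :
    x ^ n ≤ n.factorial * h ^ n * Real.exp (x / h) := by
  have h1 := Real.pow_div_factorial_le_exp (x / h) (by positivity) n
  have hn : (0 : ℝ) < n.factorial := by exact_mod_cast n.factorial_pos
  rw [div_pow, div_div, div_le_iff₀ (by positivity)] at h1
  linarith

/-- For every `ε > 0`, the kernels `w ↦ e^{(z,w) - |w|²}` satisfy Gevrey estimates of order `1` on
compact subsets of the polydisc with radius `r`, uniform in `z` up to a factor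
`e^{∑ (r_j + ε) |z_j|}`. -/
theorem exists_gevreyBound_bargmannKernel {d : ℕ} {K : Set (Fin d → ℂ)} (hK : IsCompact K)
    {r : Fin d → ℝ} (hKr : K ⊆ closedPolydisc r) {ε : ℝ} (hε : 0 < ε) :
    ∃ h C : ℝ, 0 < h ∧ 0 ≤ C ∧ ∀ z : Fin d → ℂ,
      GevreyBound 1 K h (C * Real.exp (∑ j, (r j + ε) * ‖z j‖)) (bargmannKernel z) := by
  obtain ⟨-, hb⟩ := mem_gevreyFunctions_of_analytic le_rfl ⊤
    (analyticOnNhd_bargmannKernel (0 : Fin d → ℂ))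
  obtain ⟨h₀, C, hh₀, hC, b⟩ := hb K hK (subset_univ _)
  -- `h₀` controls the Gaussian factor and `ε⁻¹` the exponential one. The extra factor `2` in `2 *
  -- m` absorbs the `n + 1 ≤ 2^n` terms of the Leibniz rule.
  set m := max h₀ ε⁻¹ with hm
  have hm0 : 0 < m := lt_max_of_lt_left hh₀
  refine ⟨2 * m, C, by positivity, hC, fun z n w hw => ?_⟩
  have hk0 : ContDiff ℝ ∞ (bargmannKernel (0 : Fin d → ℂ)) :=
    contDiff_iff_contDiffAt.2 fun w =>
      (analyticOnNhd_bargmannKernel (0 : Fin d → ℂ) w (mem_univ _)).contDiffAt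
  have hc : ContDiff ℝ ∞ fun y => Complex.exp (conjPairing z y) :=
    Complex.contDiff_exp.comp (conjPairing z).contDiff
  have e : bargmannKernel z = fun w => Complex.exp (conjPairing z w) * bargmannKernel 0 w :=
    funext fun w => bargmannKernel_eq_mul z w
  rw [e, Real.rpow_one]
  refine (norm_iteratedFDeriv_mul_le hc hk0 w (n := n) (by exact_mod_cast le_top)).trans ?_
  set X := Real.exp (∑ j, (r j + ε) * ‖z j‖) with hX
  have hX' : Real.exp ((∑ j, ‖z j‖) / ε⁻¹) * Real.exp (∑ j, r j * ‖z j‖) = X := by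
    rw [hX, ← Real.exp_add]
    congr 1
    rw [div_inv_eq_mul, Finset.sum_mul, ← Finset.sum_add_distrib]
    exact Finset.sum_congr rfl fun j _ => by ring
  have key : ∀ i ∈ Finset.range (n + 1),
      (n.choose i : ℝ) * ‖iteratedFDeriv ℝ i (fun y => Complex.exp (conjPairing z y)) w‖ *
        ‖iteratedFDeriv ℝ (n - i) (bargmannKernel 0) w‖ ≤ n.factorial * m ^ n * C * X := by
    intro i hi
    have hin : i ≤ n := Nat.lt_succ_iff.1 (Finset.mem_range.1 hi)
    have h1 : ‖iteratedFDeriv ℝ i (fun y => Complex.exp (conjPairing z y)) w‖ ≤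
        i.factorial * m ^ i * X := by
      refine (norm_iteratedFDeriv_cexp_clm_le _ i w).trans ?_
      calc _ ≤ (∑ j, ‖z j‖) ^ i * Real.exp (∑ j, r j * ‖z j‖) := by
            gcongr
            · exact norm_conjPairing_le z
            · exact norm_exp_conjPairing_le (hKr hw)
        _ ≤ (i.factorial * ε⁻¹ ^ i * Real.exp ((∑ j, ‖z j‖) / ε⁻¹)) *
            Real.exp (∑ j, r j * ‖z j‖) := by
            gcongr
            exact pow_le_factorial_mul_exp (by positivity) (by positivity) i
        _ = i.factorial * ε⁻¹ ^ i * X := by rw [mul_assoc, hX']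
        _ ≤ _ := by
            gcongr
            exact le_max_right _ _
    have h2 : ‖iteratedFDeriv ℝ (n - i) (bargmannKernel (0 : Fin d → ℂ)) w‖ ≤
        C * m ^ (n - i) * (n - i).factorial := by
      refine (b (n - i) w hw).trans ?_
      rw [Real.rpow_one]
      gcongr
      exact le_max_left _ _
    calc _ ≤ (n.choose i : ℝ) * (i.factorial * m ^ i * X) *
          (C * m ^ (n - i) * (n - i).factorial) := by gcongr
      _ = ((n.choose i * i.factorial * (n - i).factorial : ℕ) : ℝ) * (m ^ i * m ^ (n - i)) *
          C * X := by push_cast; ring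
      _ = _ := by rw [Nat.choose_mul_factorial_mul_factorial hin, ← pow_add, Nat.add_sub_cancel' hin]
  refine (Finset.sum_le_sum key).trans ?_
  rw [Finset.sum_const, Finset.card_range, nsmul_eq_mul]
  have h2 : ((n + 1 : ℕ) : ℝ) ≤ 2 ^ n := by exact_mod_cast Nat.lt_two_pow_self
  calc _ ≤ (2 : ℝ) ^ n * (n.factorial * m ^ n * C * X) := by gcongr
    _ = _ := by ring

theorem exists_exponential_type_of_gevrey {d : ℕ} {s : ℝ} (hs : 1 ≤ s) {r₀ r : Fin d → ℝ}
    (hr₀ : ∀ j, 0 < r₀ j) (hr : ∀ j, r₀ j < r j)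
    {u : gevreyFunctions s (openPolydiscOpens r₀) →ₗ[ℂ] ℂ} (hu : IsGevreyDistribution u) :
    ∃ r₁ : Fin d → ℝ, (∀ j, 0 < r₁ j) ∧ (∀ j, r₁ j < r j) ∧
      ∃ C : ℝ, ∀ z, ‖bargmannProjGevrey hs u z‖ ≤ C * Real.exp (∑ j, r₁ j * ‖z j‖) := by
  obtain ⟨K, hK, hKr, hb⟩ := hu
  obtain ⟨ε, hε, hεr⟩ : ∃ ε : ℝ, 0 < ε ∧ ∀ j, r₀ j + ε < r j := by
    have h : ∀ᶠ ε in nhdsWithin (0 : ℝ) (Ioi 0), ∀ j, r₀ j + ε < r j :=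
      Filter.eventually_all.2 fun j => by
        have : Filter.Tendsto (fun ε : ℝ => r₀ j + ε) (nhdsWithin 0 (Ioi 0)) (nhds (r₀ j + 0)) :=
          ((continuous_const.add continuous_id).tendsto 0).mono_left nhdsWithin_le_nhds
        exact this.eventually_lt_const (by simpa using hr j)
    obtain ⟨ε, h1, h2⟩ := (h.and self_mem_nhdsWithin).exists
    exact ⟨ε, h2, h1⟩
  have hKc : K ⊆ closedPolydisc r₀ := fun w hw j => (hKr hw j).le
  obtain ⟨h, C, hh, hC, b⟩ := exists_gevreyBound_bargmannKernel hK hKc hε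
  -- Continuity holds for every `h`, in particular for the one supplied by the kernel, which does
  -- not depend on `z`.
  obtain ⟨C', hC'⟩ := hb h hh
  refine ⟨fun j => r₀ j + ε, fun j => add_pos (hr₀ j) hε, hεr,
    ‖((Real.pi : ℂ) ^ d)⁻¹‖ * (C' * C), fun z => ?_⟩
  rw [bargmannProjGevrey, norm_mul, mul_assoc, mul_assoc]
  refine mul_le_mul_of_nonneg_left (hC' _ _ (by positivity) fun n w hw => ?_) (norm_nonneg _)
  refine (b z n w hw).trans ?_
  have : (1 : ℝ) ≤ n.factorial := by exact_mod_cast n.factorial_pos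
  gcongr

/-! ### Bounded functions with compact support -/

theorem isCompact_closedPolydisc {d : ℕ} (r : Fin d → ℝ) : IsCompact (closedPolydisc r) := by
  have e : closedPolydisc r = Set.pi univ fun j => Metric.closedBall (0 : ℂ) (r j) := by
    ext z
    simp [closedPolydisc]
  rw [e]
  exact isCompact_univ_pi fun j => isCompact_closedBall _ _

theorem integrableOn_of_memLp_top {d : ℕ} {F : (Fin d → ℂ) → ℂ} (hF : MemLp F ∞ volume)
    {K : Set (Fin d → ℂ)} (hK : IsCompact K) : IntegrableOn F K := by
  have : IsFiniteMeasure (volume.restrict K) := isFiniteMeasure_restrict.2 hK.measure_lt_top.ne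
  exact (hF.restrict K).integrable le_top

theorem integrable_mul_of_continuousOn {d : ℕ} {f g : (Fin d → ℂ) → ℂ} {K : Set (Fin d → ℂ)}
    (hK : IsCompact K) (hf : ContinuousOn f K) (hg : IntegrableOn g K)
    (hgK : ∀ᵐ w, w ∉ K → g w = 0) : Integrable fun w => f w * g w := by
  refine (hg.continuousOn_mul hf hK).integrable_of_ae_notMem_eq_zero ?_
  filter_upwards [hgK] with w hw hwK
  rw [hw hwK, mul_zero]

theorem hasSum_integral_mul_of_compact_support {d : ℕ} {ι : Type*} [Countable ι]
    {f : ι → (Fin d → ℂ) → ℂ} {S g : (Fin d → ℂ) → ℂ} {K : Set (Fin d → ℂ)} {u : ι → ℝ}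
    (hK : IsCompact K) (hg : IntegrableOn g K) (hgK : ∀ᵐ w, w ∉ K → g w = 0)
    (hf : ∀ i, ContinuousOn (f i) K) (hfu : ∀ i, ∀ w ∈ K, ‖f i w‖ ≤ u i) (hu : Summable u)
    (hS : ∀ w ∈ K, HasSum (fun i => f i w) (S w)) :
    HasSum (fun i => ∫ w, f i w * g w) (∫ w, S w * g w) := by
  have hgi : Integrable g := hg.integrable_of_ae_notMem_eq_zero hgK
  refine hasSum_integral_of_dominated_convergence (fun i w => u i * ‖g w‖)
    (fun i => (integrable_mul_of_continuousOn hK (hf i) hg hgK).aestronglyMeasurable)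
    (fun i => ?_) (ae_of_all _ fun w => hu.mul_right _) ?_ ?_
  · filter_upwards [hgK] with w hw
    by_cases hwK : w ∈ K
    · rw [norm_mul]
      gcongr
      exact hfu i w hwK
    · simp [hw hwK]
  · simp only [tsum_mul_right]
    exact hgi.norm.const_mul _
  · filter_upwards [hgK] with w hw
    by_cases hwK : w ∈ K
    · exact (hS w hwK).mul_right _
    · simp [hw hwK]

/-! ### Moments of radial weights -/

theorem measurePreserving_rotation_pi {d : ℕ} (c : Fin d → Circle) :
    MeasurePreserving (fun (w : Fin d → ℂ) j => (c j : ℂ) * w j) volume volume :=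
  volume_preserving_pi fun j => (rotation (c j)).measurePreserving

theorem measurableEmbedding_rotation_pi {d : ℕ} (c : Fin d → Circle) :
    MeasurableEmbedding (fun (w : Fin d → ℂ) j => (c j : ℂ) * w j) :=
  (MeasurableEquiv.piCongrRight fun j => (rotation (c j)).toMeasurableEquiv).measurableEmbedding

/-- Rotation by `θ` multiplies `w^m \bar w^n` by `e^{i(m-n)θ}`; here `(m-n)θ = π`. -/
theorem circle_exp_pow_mul_conj_pow {m n : ℕ} (h : m ≠ n) :
    ((Circle.exp (Real.pi / ((m : ℝ) - n)) : Circle) : ℂ) ^ m *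
      (starRingEnd ℂ) (Circle.exp (Real.pi / ((m : ℝ) - n)) : ℂ) ^ n = -1 := by
  have h' : (m : ℂ) - n ≠ 0 := sub_ne_zero.2 (by exact_mod_cast h)
  rw [← Circle.coe_inv_eq_conj, ← Circle.exp_neg, Circle.coe_exp, Circle.coe_exp,
    ← Complex.exp_nat_mul, ← Complex.exp_nat_mul, ← Complex.exp_add, ← Complex.exp_pi_mul_I]
  congr 1
  push_cast
  field_simp
  ring

/-- Different monomials are orthogonal with respect to a radial weight. -/
theorem integral_monomial_mul_conj_monomial_eq_zero {d : ℕ} {g : (Fin d → ℂ) → ℂ}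
    {g₀ : (Fin d → ℝ) → ℂ} (hg : ∀ᵐ w, g w = g₀ fun j => ‖w j‖) {α β : Fin d → ℕ} (h : α ≠ β) :
    ∫ w, (∏ j, w j ^ α j) * (∏ j, (starRingEnd ℂ) (w j) ^ β j) * g w = 0 := by
  obtain ⟨j₀, hj⟩ := Function.ne_iff.1 h
  set G : (Fin d → ℂ) → ℂ := fun w =>
    (∏ j, w j ^ α j) * (∏ j, (starRingEnd ℂ) (w j) ^ β j) * g₀ (fun j => ‖w j‖) with hG
  have e : ∫ w, (∏ j, w j ^ α j) * (∏ j, (starRingEnd ℂ) (w j) ^ β j) * g w = ∫ w, G w :=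
    integral_congr_ae (by filter_upwards [hg] with w hw; rw [hw])
  -- Rotating only a coordinate where the exponents differ preserves the measure and the weight but
  -- changes the sign of the integrand, so the integral equals its own negative.
  let c : Fin d → Circle := Function.update 1 j₀ (Circle.exp (Real.pi / ((α j₀ : ℝ) - β j₀)))
  have hc : (∏ j, (c j : ℂ) ^ α j * (starRingEnd ℂ) (c j : ℂ) ^ β j) = -1 := by
    rw [Finset.prod_eq_single j₀ (fun j _ hne => by simp [c, hne])
      (fun h => (h (Finset.mem_univ _)).elim)]
    simpa only [c, Function.update_self] using circle_exp_pow_mul_conj_pow hj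
  have hrot : ∀ w : Fin d → ℂ, G (fun j => (c j : ℂ) * w j) = -G w := fun w => by
    simp only [hG, norm_mul, Circle.norm_coe, one_mul, map_mul, mul_pow, Finset.prod_mul_distrib]
    rw [Finset.prod_mul_distrib] at hc
    linear_combination ((∏ j, w j ^ α j) * (∏ j, (starRingEnd ℂ) (w j) ^ β j) *
      g₀ (fun j => ‖w j‖)) * hc
  have hI := (measurePreserving_rotation_pi c).integral_comp (measurableEmbedding_rotation_pi c) G
  simp only [hrot, integral_neg] at hI
  rw [e]
  linear_combination -(1 / 2 : ℂ) * hI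

theorem hasSum_exp_conjPairing {d : ℕ} (z w : Fin d → ℂ) :
    HasSum (fun β : Fin d → ℕ =>
      (∏ j, z j ^ β j / (β j).factorial) * ∏ j, (starRingEnd ℂ) (w j) ^ β j)
      (Complex.exp (conjPairing z w)) := by
  have h := (summable_norm_and_hasSum_prod_pi
    (fun j n => (z j * (starRingEnd ℂ) (w j)) ^ n / (n.factorial : ℂ))
    fun j => NormedSpace.norm_expSeries_div_summable _).2
  rw [conjPairing_apply, Complex.exp_sum]
  have e1 : ∀ β : Fin d → ℕ,
      (∏ j, z j ^ β j / ((β j).factorial : ℂ)) * ∏ j, (starRingEnd ℂ) (w j) ^ β j =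
        ∏ j, (z j * (starRingEnd ℂ) (w j)) ^ β j / ((β j).factorial : ℂ) := fun β => by
    rw [← Finset.prod_mul_distrib]
    exact Finset.prod_congr rfl fun j _ => by rw [mul_pow]; ring
  have e2 : ∀ x : ℂ, ∑' n : ℕ, x ^ n / (n.factorial : ℂ) = Complex.exp x := fun x => by
    rw [Complex.exp_eq_exp_ℂ]
    exact (NormedSpace.expSeries_div_hasSum_exp x).tsum_eq
  simp only [e1]
  simpa only [e2] using h

theorem norm_prod_pow_le_of_mem_closedPolydisc {d : ℕ} {t : Fin d → ℝ} {w : Fin d → ℂ}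
    (hw : w ∈ closedPolydisc t) (α : Fin d → ℕ) : ‖∏ j, w j ^ α j‖ ≤ ∏ j, t j ^ α j := by
  simp only [norm_prod, norm_pow]
  exact Finset.prod_le_prod (fun _ _ => by positivity) fun j _ =>
    pow_le_pow_left₀ (norm_nonneg _) (hw j) _

/-- The diagonal action of `Π_A` on monomials: after expanding `e^{(z,w)}` and integrating termwise,
orthogonality leaves only `β = α`. -/
theorem integral_monomial_mul_exp_conjPairing {d : ℕ} {g : (Fin d → ℂ) → ℂ}
    {g₀ : (Fin d → ℝ) → ℂ} (hg₀ : ∀ᵐ w, g w = g₀ fun j => ‖w j‖) {t : Fin d → ℝ}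
    (hg : IntegrableOn g (closedPolydisc t)) (hgt : ∀ᵐ w, w ∉ closedPolydisc t → g w = 0)
    (α : Fin d → ℕ) (z : Fin d → ℂ) :
    ∫ w, (∏ j, w j ^ α j) * Complex.exp (conjPairing z w) * g w =
      (∏ j, z j ^ α j / (α j).factorial) *
        ∫ w, (∏ j, w j ^ α j) * (∏ j, (starRingEnd ℂ) (w j) ^ α j) * g w := by
  have h := hasSum_integral_mul_of_compact_support
    (f := fun (β : Fin d → ℕ) w => (∏ j, w j ^ α j) *
      ((∏ j, z j ^ β j / (β j).factorial) * ∏ j, (starRingEnd ℂ) (w j) ^ β j))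
    (S := fun w => (∏ j, w j ^ α j) * Complex.exp (conjPairing z w))
    (u := fun β => (∏ j, t j ^ α j) * ∏ j, (‖z j‖ * t j) ^ β j / (β j).factorial)
    (isCompact_closedPolydisc t) hg hgt
    (fun β => by fun_prop) (fun β w hw => ?_)
    ((summable_prod_pi _ fun j => Real.summable_pow_div_factorial _).mul_left _)
    (fun w _ => (hasSum_exp_conjPairing z w).mul_left _)
  · have hz : ∀ β : Fin d → ℕ, ∫ w, (∏ j, w j ^ α j) *
        ((∏ j, z j ^ β j / (β j).factorial) * ∏ j, (starRingEnd ℂ) (w j) ^ β j) * g w =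
        (∏ j, z j ^ β j / (β j).factorial) *
          ∫ w, (∏ j, w j ^ α j) * (∏ j, (starRingEnd ℂ) (w j) ^ β j) * g w := fun β => by
      rw [← integral_const_mul]
      congr 1
      funext w
      ring
    simp only [hz] at h
    refine h.unique (hasSum_single α fun β hβ => ?_)
    rw [integral_monomial_mul_conj_monomial_eq_zero hg₀ hβ.symm, mul_zero]
  · have ht : ∀ j, 0 ≤ t j := fun j => (norm_nonneg _).trans (hw j)
    have hw' : (fun j => (starRingEnd ℂ) (w j)) ∈ closedPolydisc t := fun j => by
      simpa using hw j
    rw [norm_mul, norm_mul]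
    calc _ ≤ (∏ j, t j ^ α j) * ((∏ j, ‖z j‖ ^ β j / (β j).factorial) * ∏ j, t j ^ β j) := by
          refine mul_le_mul (norm_prod_pow_le_of_mem_closedPolydisc hw α)
            (mul_le_mul (le_of_eq ?_) (norm_prod_pow_le_of_mem_closedPolydisc hw' β)
              (norm_nonneg _) (by positivity)) (by positivity) ?_
          · simp [norm_prod]
          · exact Finset.prod_nonneg fun j _ => pow_nonneg (ht j) _
      _ = _ := by
          rw [← Finset.prod_mul_distrib]
          congr 1
          exact Finset.prod_congr rfl fun j _ => by rw [mul_pow]; ring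

/-! ### The weight `χ e^{-|w|²}` -/

/-- The Gaussian `e^{-|w|²}`. -/
noncomputable def gaussian {d : ℕ} (w : Fin d → ℂ) : ℝ := Real.exp (-∑ j, ‖w j‖ ^ 2)

theorem bargmannKernel_eq_exp_mul_gaussian {d : ℕ} (z w : Fin d → ℂ) :
    bargmannKernel z w = Complex.exp (conjPairing z w) * (gaussian w : ℂ) := by
  rw [conjPairing_apply, bargmannKernel, gaussian, Complex.ofReal_exp, ← Complex.exp_add]
  congr 1
  push_cast
  ring

theorem continuous_gaussian {d : ℕ} : Continuous (gaussian : (Fin d → ℂ) → ℝ) := by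
  unfold gaussian
  fun_prop

theorem gaussian_pos {d : ℕ} (w : Fin d → ℂ) : 0 < gaussian w := Real.exp_pos _

theorem isOpen_openPolydisc {d : ℕ} (r : Fin d → ℝ) : IsOpen (openPolydisc r) :=
  (openPolydiscOpens r).isOpen

namespace IsPosBoundedRadial

variable {d : ℕ} {t₁ t₂ : Fin d → ℝ} {χ : (Fin d → ℂ) → ℝ}

theorem integrableOn_weight (h : IsPosBoundedRadial t₁ t₂ χ) :
    IntegrableOn (fun w => ((χ w * gaussian w : ℝ) : ℂ)) (closedPolydisc t₂) := by
  have h1 := integrableOn_of_memLp_top h.memLp_top.ofReal (isCompact_closedPolydisc t₂)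
  have h2 := h1.mul_continuousOn (g' := fun w => (gaussian w : ℂ))
    (Complex.continuous_ofReal.comp continuous_gaussian).continuousOn (isCompact_closedPolydisc t₂)
  refine h2.congr_fun_ae (ae_of_all _ fun w => ?_)
  push_cast
  rfl

theorem weight_eq_zero (h : IsPosBoundedRadial t₁ t₂ χ) :
    ∀ᵐ w, w ∉ closedPolydisc t₂ → ((χ w * gaussian w : ℝ) : ℂ) = 0 := by
  filter_upwards [h.support] with w hw hwt
  simp [hw hwt]

theorem weight_radial (h : IsPosBoundedRadial t₁ t₂ χ) :
    ∃ g₀ : (Fin d → ℝ) → ℂ, ∀ᵐ w, ((χ w * gaussian w : ℝ) : ℂ) = g₀ fun j => ‖w j‖ := by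
  obtain ⟨χ₀, h₀⟩ := h.radial
  refine ⟨fun x => ((χ₀ x * Real.exp (-∑ j, x j ^ 2) : ℝ) : ℂ), ?_⟩
  filter_upwards [h₀] with w hw
  rw [hw, gaussian]

/-- The moments of `χ e^{-|w|²}` are real and bounded from below by those of a torus with
multiradius less than `t₁`. -/
theorem exists_moment (h : IsPosBoundedRadial t₁ t₂ χ) {τ : Fin d → ℝ} (hτ : ∀ j, 0 < τ j)
    (hτt : ∀ j, τ j < t₁ j) :
    ∃ m : (Fin d → ℕ) → ℝ, ∃ κ : ℝ, 0 < κ ∧ (∀ α, κ * ∏ j, (τ j ^ 2) ^ α j ≤ m α) ∧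
      ∀ α, ∫ w, (∏ j, w j ^ α j) * (∏ j, (starRingEnd ℂ) (w j) ^ α j) *
        ((χ w * gaussian w : ℝ) : ℂ) = m α := by
  obtain ⟨c, hc, hlow⟩ := h.lower_bound
  have e : ∀ (α : Fin d → ℕ) (w : Fin d → ℂ),
      (∏ j, w j ^ α j) * (∏ j, (starRingEnd ℂ) (w j) ^ α j) * ((χ w * gaussian w : ℝ) : ℂ) =
        (((∏ j, (‖w j‖ ^ 2) ^ α j) * (χ w * gaussian w) : ℝ) : ℂ) := fun α w => by
    rw [← Finset.prod_mul_distrib, Complex.ofReal_mul (∏ j, _), Complex.ofReal_prod]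
    congr 1
    refine Finset.prod_congr rfl fun j _ => ?_
    rw [← mul_pow, Complex.mul_conj, Complex.normSq_eq_norm_sq]
    push_cast
    rfl
  -- On this shell of positive volume the weight is at least `c e^{-∑ t₁_j²}` and each `‖w j‖`
  -- exceeds `τ j`.
  let A : Set (Fin d → ℂ) := {w | ∀ j, τ j < ‖w j‖} ∩ openPolydisc t₁
  have hAo : IsOpen A := by
    refine IsOpen.inter ?_ (isOpen_openPolydisc _)
    rw [Set.ofPred_forall]
    exact isOpen_iInter_of_finite fun j => isOpen_lt continuous_const (continuous_apply j).norm
  have hAn : A.Nonempty := by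
    refine ⟨fun j => (((τ j + t₁ j) / 2 : ℝ) : ℂ), fun j => ?_, fun j => ?_⟩ <;>
    · have h1 := hτ j
      have h2 := hτt j
      rw [Complex.norm_real, Real.norm_of_nonneg (by linarith)]
      linarith
  have hAt : A ⊆ closedPolydisc t₁ := fun w hw j => (hw.2 j).le
  have hAfin : volume A ≠ ⊤ :=
    ((measure_mono hAt).trans_lt (isCompact_closedPolydisc t₁).measure_lt_top).ne
  have hApos : 0 < volume.real A :=
    ENNReal.toReal_pos (hAo.measure_pos volume hAn).ne' hAfin
  refine ⟨fun α => ∫ w, (∏ j, (‖w j‖ ^ 2) ^ α j) * (χ w * gaussian w),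
    volume.real A * (c * Real.exp (-∑ j, t₁ j ^ 2)), by positivity, fun α => ?_, fun α => ?_⟩
  · have hint : Integrable fun w => (∏ j, (‖w j‖ ^ 2) ^ α j) * (χ w * gaussian w) := by
      have h1 := integrable_mul_of_continuousOn
        (f := fun w => (∏ j, w j ^ α j) * (∏ j, (starRingEnd ℂ) (w j) ^ α j))
        (isCompact_closedPolydisc t₂) (by fun_prop) h.integrableOn_weight h.weight_eq_zero
      simp only [e] at h1
      exact h1.re.congr (ae_of_all _ fun w => Complex.ofReal_re _)
    have hle := integral_mono_ae (μ := volume)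
      (f := A.indicator fun _ => (c * Real.exp (-∑ j, t₁ j ^ 2)) * ∏ j, (τ j ^ 2) ^ α j)
      (g := fun w => (∏ j, (‖w j‖ ^ 2) ^ α j) * (χ w * gaussian w))
      ((integrable_indicator_iff hAo.measurableSet).2 (integrableOn_const hAfin)) hint ?_
    · rw [integral_indicator_const _ hAo.measurableSet, smul_eq_mul] at hle
      linarith
    · filter_upwards [hlow, h.nonneg] with w hw hw0
      by_cases hwA : w ∈ A
      · rw [indicator_of_mem hwA, mul_comm]
        have h1 : Real.exp (-∑ j, t₁ j ^ 2) ≤ gaussian w := by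
          unfold gaussian
          gcongr with j
          exact hAt hwA j
        have h2 : ∏ j, (τ j ^ 2) ^ α j ≤ ∏ j, (‖w j‖ ^ 2) ^ α j :=
          Finset.prod_le_prod (fun j _ => by positivity) fun j _ => by
            have := (hwA.1 j).le
            have := hτ j
            gcongr
        have := hw hwA.2
        gcongr
      · rw [indicator_of_notMem hwA]
        have := gaussian_pos w
        positivity
  · simp only [e]
    exact integral_ofReal

end IsPosBoundedRadial

/-! ### The implications -/

theorem summable_add_one_mul_pow {q : ℝ} (h0 : 0 ≤ q) (h1 : q < 1) :
    Summable fun n : ℕ => ((n : ℝ) + 1) * q ^ n := by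
  have hq : ‖q‖ < 1 := by rwa [Real.norm_of_nonneg h0]
  have h := (summable_pow_mul_geometric_of_norm_lt_one 1 hq).add
    (summable_geometric_of_lt_one h0 h1)
  refine h.congr fun n => ?_
  rw [pow_one]
  ring

/-- Inverts the diagonal operator. The factorials in `c α` cancel those in the Taylor bounds,
leaving a product of series `∑ (n+1) q_j^n` with `q_j = r₀_j ρ_j / τ_j² < 1`. -/
theorem IsPosBoundedRadial.exists_bargmannProj_eq {d : ℕ} {F : (Fin d → ℂ) → ℂ}
    (hF : AnalyticOnNhd ℂ F univ) {r₀ τ t₁ t₂ ρ : Fin d → ℝ} (hr₀ : ∀ j, 0 < r₀ j) {C : ℝ}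
    (hC : ∀ z, ‖F z‖ ≤ C * Real.exp (∑ j, r₀ j * ‖z j‖)) {χ : (Fin d → ℂ) → ℝ}
    (hχ : IsPosBoundedRadial t₁ t₂ χ) (hτ : ∀ j, 0 < τ j) (hτt : ∀ j, τ j < t₁ j)
    (hρ : ∀ j, t₂ j ≤ ρ j) (hρτ : ∀ j, r₀ j * ρ j < τ j ^ 2) :
    ∃ F₀ : (Fin d → ℂ) → ℂ, AnalyticOnNhd ℂ F₀ (openPolydisc ρ) ∧
      F = bargmannProj (fun w => F₀ w * (χ w : ℂ)) := by
  have hC0 : 0 ≤ C := by simpa using (norm_nonneg _).trans (hC 0)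
  have ht₂ : ∀ j, 0 < t₂ j := fun j => (hχ.t₁_pos j).trans_le (hχ.t₁_le_t₂ j)
  have hρ0 : ∀ j, 0 < ρ j := fun j => (ht₂ j).trans_le (hρ j)
  obtain ⟨a, ha, hsum⟩ := exists_hasSum_of_exponential_type hr₀ hF hC
  obtain ⟨m, κ, hκ, hm, hmint⟩ := hχ.exists_moment hτ hτt
  obtain ⟨g₀, hg₀⟩ := hχ.weight_radial
  have hτα : ∀ α : Fin d → ℕ, 0 < ∏ j, (τ j ^ 2) ^ α j := fun α =>
    Finset.prod_pos fun j _ => pow_pos (pow_pos (hτ j) 2) _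
  have hm0 : ∀ α, 0 < m α := fun α => (mul_pos hκ (hτα α)).trans_le (hm α)
  let c : (Fin d → ℕ) → ℂ := fun α =>
    a α * (Real.pi ^ d * (∏ j, ((α j).factorial : ℝ)) / m α : ℝ)
  have hc : Summable fun α => ‖c α‖ * ∏ j, ρ j ^ α j := by
    have h1 : Summable fun α : Fin d → ℕ => C * Real.pi ^ d / κ *
        ∏ j, Real.exp 1 * (((α j : ℝ) + 1) * (r₀ j * ρ j / τ j ^ 2) ^ α j) :=
      (summable_prod_pi _ fun j => (summable_add_one_mul_pow
        (div_nonneg (mul_nonneg (hr₀ j).le (hρ0 j).le) (sq_nonneg _))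
        ((div_lt_one (pow_pos (hτ j) 2)).2 (hρτ j))).mul_left _).mul_left _
    refine Summable.of_nonneg_of_le (fun α => mul_nonneg (norm_nonneg _)
      (Finset.prod_nonneg fun j _ => pow_nonneg (hρ0 j).le _)) (fun α => ?_) h1
    have hpos : (0 : ℝ) ≤ Real.pi ^ d * ∏ j, ((α j).factorial : ℝ) := by positivity
    have hρα : 0 ≤ ∏ j, ρ j ^ α j := Finset.prod_nonneg fun j _ => pow_nonneg (hρ0 j).le _
    have hT : 0 ≤ ∏ j, taylorBound (r₀ j) (α j) :=
      Finset.prod_nonneg fun j _ => taylorBound_nonneg (hr₀ j).le _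
    calc ‖c α‖ * ∏ j, ρ j ^ α j
        ≤ (C * ∏ j, taylorBound (r₀ j) (α j)) * (Real.pi ^ d * (∏ j, ((α j).factorial : ℝ)) /
            (κ * ∏ j, (τ j ^ 2) ^ α j)) * ∏ j, ρ j ^ α j := by
          rw [norm_mul, Complex.norm_real, Real.norm_of_nonneg (div_nonneg hpos (hm0 α).le)]
          have := hτα α
          gcongr
          · exact div_nonneg hpos (hm0 α).le
          · exact ha α
          · exact hm α
      _ = C * Real.pi ^ d / κ * ((∏ j, taylorBound (r₀ j) (α j)) *
            (∏ j, ((α j).factorial : ℝ)) * (∏ j, ρ j ^ α j) / ∏ j, (τ j ^ 2) ^ α j) := by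
          have := (hτα α).ne'
          field_simp
      _ = _ := by
          rw [← Finset.prod_mul_distrib, ← Finset.prod_mul_distrib, ← Finset.prod_div_distrib]
          congr 1
          refine Finset.prod_congr rfl fun j _ => ?_
          have : ((α j).factorial : ℝ) ≠ 0 := by exact_mod_cast (α j).factorial_ne_zero
          rw [taylorBound, div_pow, mul_pow]
          field_simp
  refine ⟨fun w => ∑' α, c α * ∏ j, w j ^ α j, analyticOnNhd_tsum_monomial hρ0 hc,
    funext fun z => ?_⟩
  have hcw : ∀ w ∈ closedPolydisc t₂, ∀ α, ‖c α * ∏ j, w j ^ α j‖ ≤ ‖c α‖ * ∏ j, ρ j ^ α j :=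
    fun w hw α => by
      rw [norm_mul]
      exact mul_le_mul_of_nonneg_left (norm_prod_pow_le_of_mem_closedPolydisc
        (fun j => (hw j).trans (hρ j)) α) (norm_nonneg _)
  have hI := hasSum_integral_mul_of_compact_support
    (f := fun (α : Fin d → ℕ) w => c α * (∏ j, w j ^ α j) * Complex.exp (conjPairing z w))
    (S := fun w => (∑' α, c α * ∏ j, w j ^ α j) * Complex.exp (conjPairing z w))
    (u := fun α => (‖c α‖ * ∏ j, ρ j ^ α j) * Real.exp (∑ j, t₂ j * ‖z j‖))
    (isCompact_closedPolydisc t₂) hχ.integrableOn_weight hχ.weight_eq_zero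
    (fun α => by fun_prop)
    (fun α w hw => by
      rw [norm_mul]
      exact mul_le_mul (hcw w hw α) (norm_exp_conjPairing_le hw) (norm_nonneg _)
        ((norm_nonneg _).trans (hcw w hw α)))
    (hc.mul_right _)
    (fun w hw => (Summable.of_norm_bounded hc (hcw w hw)).hasSum.mul_right _)
  have hterm : ∀ α : Fin d → ℕ,
      ∫ w, c α * (∏ j, w j ^ α j) * Complex.exp (conjPairing z w) *
        ((χ w * gaussian w : ℝ) : ℂ) = (Real.pi : ℂ) ^ d * (a α * ∏ j, z j ^ α j) := fun α => by
    have h1 := integral_monomial_mul_exp_conjPairing hg₀ hχ.integrableOn_weight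
      hχ.weight_eq_zero α z
    simp only [mul_assoc (c α)]
    rw [integral_const_mul]
    simp only [← mul_assoc] at h1 ⊢
    rw [h1, hmint α, Finset.prod_div_distrib]
    have h2 : (m α : ℂ) ≠ 0 := by exact_mod_cast (hm0 α).ne'
    have h3 : (∏ j, ((α j).factorial : ℂ)) ≠ 0 :=
      Finset.prod_ne_zero_iff.2 fun j _ => by exact_mod_cast (α j).factorial_ne_zero
    simp only [c]
    push_cast
    field_simp
  simp only [hterm] at hI
  have hFz := hI.unique ((hsum z).mul_left _)
  have hpi : (Real.pi : ℂ) ^ d ≠ 0 := pow_ne_zero _ (by exact_mod_cast Real.pi_ne_zero)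
  rw [bargmannProj, eq_inv_mul_iff_mul_eq₀ hpi, ← hFz]
  congr 1
  funext w
  rw [bargmannKernel_eq_exp_mul_gaussian]
  push_cast
  ring

theorem isPosBoundedRadial_indicator {d : ℕ} {t₁ t₂ : Fin d → ℝ} (h₁ : ∀ j, 0 < t₁ j)
    (h : ∀ j, t₁ j ≤ t₂ j) : IsPosBoundedRadial t₁ t₂ ((closedPolydisc t₁).indicator 1) where
  t₁_pos := h₁
  t₁_le_t₂ := h
  memLp_top := memLp_indicator_const _ (isCompact_closedPolydisc t₁).measurableSet (1 : ℝ)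
    (Or.inr (isCompact_closedPolydisc t₁).measure_lt_top.ne)
  nonneg := ae_of_all _ fun z => indicator_nonneg (fun _ _ => zero_le_one) z
  support := ae_of_all _ fun z hz =>
    indicator_of_notMem (fun hz' => hz fun j => (hz' j).trans (h j)) _
  radial := ⟨{x | ∀ j, x j ≤ t₁ j}.indicator 1, ae_of_all _ fun _ => rfl⟩
  lower_bound := ⟨1, one_pos, ae_of_all _ fun z hz => by
    have hz' : z ∈ closedPolydisc t₁ := fun j => (hz j).le
    rw [indicator_of_mem hz']
    rfl⟩

theorem IsPosBoundedRadial.isBoundedCompactlySupportedIn_mul {d : ℕ} {t₁ t₂ r : Fin d → ℝ}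
    {χ : (Fin d → ℂ) → ℝ} (h : IsPosBoundedRadial t₁ t₂ χ) (ht : ∀ j, t₂ j < r j)
    {F₀ : (Fin d → ℂ) → ℂ} (hF : ContinuousOn F₀ (closedPolydisc t₂)) :
    IsBoundedCompactlySupportedIn (openPolydisc r) fun w => F₀ w * (χ w : ℂ) := by
  have hK := isCompact_closedPolydisc t₂
  refine ⟨?_, closedPolydisc t₂, hK, fun w hw j => (hw j).trans_lt (ht j), ?_⟩
  · obtain ⟨B, hB⟩ := hK.exists_bound_of_continuousOn hF
    -- Nothing is known about `F₀` off the polydisc, not even measurability, so it is cut off there;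
    -- `χ` vanishes there almost everywhere anyway.
    have h1 : MemLp ((closedPolydisc t₂).indicator F₀) ⊤ volume := by
      refine memLp_top_of_bound ((aestronglyMeasurable_indicator_iff hK.measurableSet).2
        (hF.aestronglyMeasurable hK.measurableSet)) (max B 0) (ae_of_all _ fun w => ?_)
      by_cases hw : w ∈ closedPolydisc t₂
      · rw [indicator_of_mem hw]
        exact (hB w hw).trans (le_max_left _ _)
      · rw [indicator_of_notMem hw, norm_zero]
        exact le_max_right _ _
    have h2 : MemLp (fun w => (closedPolydisc t₂).indicator F₀ w * (χ w : ℂ)) ⊤ volume :=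
      MemLp.mul (p := ⊤) (q := ⊤) h.memLp_top.ofReal h1
    refine h2.ae_eq ?_
    filter_upwards [h.support] with w hw
    by_cases hwt : w ∈ closedPolydisc t₂
    · rw [indicator_of_mem hwt]
    · simp [hw hwt]
  · filter_upwards [h.support] with w hw hwt
    simp [hw hwt]

theorem IsCompact.exists_subset_openPolydisc {d : ℕ} {K : Set (Fin d → ℂ)} (hK : IsCompact K)
    {r : Fin d → ℝ} (hr : ∀ j, 0 < r j) (hKr : K ⊆ openPolydisc r) :
    ∃ r₀ : Fin d → ℝ, (∀ j, 0 < r₀ j) ∧ (∀ j, r₀ j < r j) ∧ K ⊆ openPolydisc r₀ := by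
  have h : ∀ j, ∃ m : ℝ, 0 < m ∧ m < r j ∧ ∀ w ∈ K, ‖w j‖ < m := fun j => by
    rcases K.eq_empty_or_nonempty with rfl | hne
    -- For empty `K` there is no maximum to exceed, and any radius in `(0, r j)` serves.
    · exact ⟨r j / 2, half_pos (hr j), half_lt_self (hr j), by simp⟩
    · obtain ⟨x, hx, hmax⟩ := hK.exists_isMaxOn hne
        (f := fun w => ‖w j‖) (continuous_apply j).norm.continuousOn
      obtain ⟨m, hm1, hm2⟩ := exists_between (hKr hx j)
      exact ⟨m, (norm_nonneg _).trans_lt hm1, hm2, fun w hw => (hmax hw).trans_lt hm1⟩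
  choose m h0 h1 h2 using h
  exact ⟨m, h0, h1, fun w hw j => h2 j w hw⟩

theorem IsBoundedCompactlySupportedIn.exists_gevreyDistribution {d : ℕ} {s : ℝ} (hs : 1 ≤ s)
    {r : Fin d → ℝ} (hr : ∀ j, 0 < r j) {F₀ : (Fin d → ℂ) → ℂ}
    (h : IsBoundedCompactlySupportedIn (openPolydisc r) F₀) :
    ∃ r₀ : Fin d → ℝ, (∀ j, 0 < r₀ j) ∧ (∀ j, r₀ j < r j) ∧
      ∃ u : gevreyFunctions s (openPolydiscOpens r₀) →ₗ[ℂ] ℂ, IsGevreyDistribution u ∧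
        bargmannProj F₀ = bargmannProjGevrey hs u := by
  obtain ⟨K, hK, hKr, hK0⟩ := h.support
  obtain ⟨r₀, hr₀, hr₀r, hKr₀⟩ := hK.exists_subset_openPolydisc hr hKr
  have hint := integrableOn_of_memLp_top h.memLp_top hK
  have hφ : ∀ φ : gevreyFunctions s (openPolydiscOpens r₀),
      IntegrableOn (fun w => F₀ w * φ.1 w) K := fun φ =>
    hint.mul_continuousOn (φ.2.1.continuousOn.mono hKr₀) hK
  let u : gevreyFunctions s (openPolydiscOpens r₀) →ₗ[ℂ] ℂ :=
    { toFun := fun φ => ∫ w in K, F₀ w * φ.1 w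
      map_add' := fun φ ψ => by
        rw [← integral_add (hφ φ) (hφ ψ)]
        congr 1
        funext w
        exact mul_add _ _ _
      map_smul' := fun c φ => by
        rw [RingHom.id_apply, smul_eq_mul, ← integral_const_mul]
        congr 1
        funext w
        exact mul_left_comm _ _ _ }
  -- Only the `n = 0` case of the Gevrey bound is needed, so the `L¹` norm of `F₀` on `K` works for
  -- every `h`.
  refine ⟨r₀, hr₀, hr₀r, u, ⟨K, hK, hKr₀, fun h _ => ⟨∫ w in K, ‖F₀ w‖, fun φ M _ hM => ?_⟩⟩,
    funext fun z => ?_⟩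
  · rw [← integral_mul_const]
    refine norm_integral_le_of_norm_le (hint.norm.mul_const M)
      (ae_restrict_of_forall_mem hK.measurableSet fun w hw => ?_)
    have h0 := hM 0 w hw
    rw [norm_iteratedFDeriv_zero, pow_zero, Nat.factorial_zero, Nat.cast_one, Real.one_rpow,
      mul_one, mul_one] at h0
    rw [norm_mul]
    gcongr
  · rw [bargmannProj, bargmannProjGevrey]
    congr 1
    refine (setIntegral_eq_integral_of_ae_compl_eq_zero ?_).symm
    filter_upwards [hK0] with w hw hwK
    rw [hw hwK, zero_mul]

/-- The geometric mean `√(r₀ r)` lies below `r`. Any `τ` strictly between satisfies `τ² / r₀ > r`,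
and `ρ` fits in that gap. -/
theorem exists_radii {r₀ r : ℝ} (h₀ : 0 < r₀) (h : r₀ < r) :
    ∃ τ t ρ : ℝ, 0 < τ ∧ τ < t ∧ t < r ∧ r < ρ ∧ r₀ * ρ < τ ^ 2 := by
  have hr : 0 < r := h₀.trans h
  have h1 : √(r₀ * r) < r := (Real.sqrt_lt' hr).2 (by nlinarith)
  obtain ⟨τ, hτ1, hτ2⟩ := exists_between h1
  obtain ⟨t, ht1, ht2⟩ := exists_between hτ2
  have hτ0 : 0 < τ := (Real.sqrt_nonneg _).trans_lt hτ1
  have h2 : r < τ ^ 2 / r₀ := by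
    rw [lt_div_iff₀ h₀, mul_comm]
    exact (Real.sqrt_lt' hτ0).1 hτ1
  obtain ⟨ρ, hρ1, hρ2⟩ := exists_between h2
  refine ⟨τ, t, ρ, hτ0, ht1, ht2, hρ1, ?_⟩
  rwa [lt_div_iff₀ h₀, mul_comm] at hρ2

theorem mainTheorem2 {d : ℕ} (F : (Fin d → ℂ) → ℂ) (hF : F ∈ analyticFunctions univ)
    (s : ℝ) (hs : 1 < s) (r : Fin d → ℝ) (hr : ∀ j, 0 < r j) :
    List.TFAE [
      -- (1) exponential type with some `r₀ < r`
      ∃ r₀ : Fin d → ℝ, (∀ j, 0 < r₀ j) ∧ (∀ j, r₀ j < r j) ∧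
        ∃ C : ℝ, ∀ z, ‖F z‖ ≤ C * Real.exp (∑ j, r₀ j * ‖z j‖),
      -- (2) every `χ`
      ∃ t₁ : Fin d → ℝ, (∀ j, 0 < t₁ j) ∧ (∀ j, t₁ j < r j) ∧
        ∀ t₂ : Fin d → ℝ, (∀ j, t₁ j ≤ t₂ j) → (∀ j, t₂ j < r j) →
          ∀ χ : (Fin d → ℂ) → ℝ, IsPosBoundedRadial t₁ t₂ χ →
            ∃ F₀ ∈ analyticFunctions (closedPolydisc r),
              F = bargmannProj (fun w => F₀ w * (χ w : ℂ)),
      -- (3) some `χ`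
      ∃ t₁ : Fin d → ℝ, (∀ j, 0 < t₁ j) ∧ (∀ j, t₁ j < r j) ∧
        ∀ t₂ : Fin d → ℝ, (∀ j, t₁ j ≤ t₂ j) → (∀ j, t₂ j < r j) →
          ∃ χ : (Fin d → ℂ) → ℝ, IsPosBoundedRadial t₁ t₂ χ ∧
            ∃ F₀ ∈ analyticFunctions (closedPolydisc r),
              F = bargmannProj (fun w => F₀ w * (χ w : ℂ)),
      -- (4) bounded functions with compact support in `D_r(0)`
      ∃ F₀ : (Fin d → ℂ) → ℂ, IsBoundedCompactlySupportedIn (openPolydisc r) F₀ ∧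
        F = bargmannProj F₀,
      -- (5) Gevrey distributions with compact support in `D_{r₀}(0)`, `r₀ < r`
      ∃ r₀ : Fin d → ℝ, (∀ j, 0 < r₀ j) ∧ (∀ j, r₀ j < r j) ∧
        ∃ u : gevreyFunctions s (openPolydiscOpens r₀) →ₗ[ℂ] ℂ, IsGevreyDistribution u ∧
          F = bargmannProjGevrey hs.le u] := by
  tfae_have 1 → 2 := by
    rintro ⟨r₀, hr₀, hr₀r, C, hC⟩
    choose τ t₁ ρ hτ hτt ht hrρ hρτ using fun j => exists_radii (hr₀ j) (hr₀r j)
    refine ⟨t₁, fun j => (hτ j).trans (hτt j), ht, fun t₂ _ ht₂ χ hχ => ?_⟩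
    obtain ⟨F₀, hF₀, e⟩ := hχ.exists_bargmannProj_eq hF hr₀ hC hτ hτt
      (fun j => ((ht₂ j).trans (hrρ j)).le) hρτ
    -- Because `ρ > r` strictly, the open polydisc of radius `ρ` contains the closed one of radius
    -- `r`.
    exact ⟨F₀, hF₀.mono fun w hw j => (hw j).trans_lt (hrρ j), e⟩
  tfae_have 2 → 3 := by
    rintro ⟨t₁, h₁, ht₁, h⟩
    refine ⟨t₁, h₁, ht₁, fun t₂ ht₁₂ ht₂ => ?_⟩
    have hχ := isPosBoundedRadial_indicator h₁ ht₁₂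
    exact ⟨_, hχ, h t₂ ht₁₂ ht₂ _ hχ⟩
  tfae_have 3 → 4 := by
    rintro ⟨t₁, h₁, ht₁, h⟩
    obtain ⟨χ, hχ, F₀, hF₀, e⟩ := h t₁ (fun _ => le_rfl) ht₁
    refine ⟨_, hχ.isBoundedCompactlySupportedIn_mul ht₁ ?_, e⟩
    exact AnalyticOnNhd.continuousOn fun w hw => hF₀ w fun j => (hw j).trans (ht₁ j).le
  tfae_have 4 → 5 := by
    rintro ⟨F₀, h₀, e⟩
    obtain ⟨r₀, hr₀, hr₀r, u, hu, eu⟩ := h₀.exists_gevreyDistribution hs.le hr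
    exact ⟨r₀, hr₀, hr₀r, u, hu, e.trans eu⟩
  tfae_have 5 → 1 := by
    rintro ⟨r₀, hr₀, hr₀r, u, hu, e⟩
    rw [e]
    exact exists_exponential_type_of_gevrey hs.le hr₀ hr₀r hu
  tfae_finish
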